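/- **Conventions.** Let $A$ be an abelian $p$-group ($p$ a prime), written additively. An automorphism $\gamma$ of a group $G$ is *inertial* if every subgroup $H$ of $G$ has finite index in $\langle H,\gamma(H)\rangle$, *finitary* if it is the identity on a subgroup of finite index, and a *power automorphism* if $\gamma(H)=H$ for every subgroup $H$. $\mathrm{IAut}(G)$ is the group generated by the inertial automorphisms of $G$; $\mathrm{FAut}(G)$ and $\mathrm{PAut}(G)$ are the groups of finitary and of power automorphisms. For an abelian $p$-group $X$, $\exp(X)$ is the smallest $m$ with $p^mX=0$, and $\mathrm{eexp}(X)$ is the smallest $e$ with $p^eX$ finite (each is $\infty$ if $X$ is unbounded). $D=D(A)$ is the largest divisible subgroup of $A$, and $\mathrm{St}(A,D)$ is the group of the automorphisms $\sigma$ of $A$ with $\sigma(a)-a\in D$ for all $a\in A$ and $\sigma(d)=d$ for all $d\in D$. $A$ is *critical* if it is the direct sum of a nonzero divisible subgroup of finite rank and an infinite bounded subgroup. If $A=D\oplus B$, then $1\oplus\gamma_0$ denotes the automorphism of $A$ that is the identity on $D$ and $\gamma_0\in\mathrm{Aut}(B)$ on $B$, and $1\oplus n$ the one that is the identity on $D$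 and multiplication by the integer $n$ on $B$. $\gamma\in\mathrm{Aut}(A)$ acts via conjugation on $\mathrm{St}(A,D)$ by $\sigma\mapsto\gamma\circ\sigma\circ\gamma^{-1}$. Products $\times$ and $\rtimes$ are internal. **Proposition.** 1) If $A$ is non-critical, then $\mathrm{IAut}(A)=\mathrm{PAut}(A)\cdot\mathrm{FAut}(A)$. If $A$ is unbounded, then $\mathrm{PAut}(A)\cap\mathrm{FAut}(A)=1$. If $A$ is infinite with $m:=\exp(A)<\infty$ and $e:=\mathrm{eexp}(A)$, then $\mathrm{PAut}(A)\cap\mathrm{FAut}(A)$ has order $p^{m-e}$, and it is cyclic except precisely when $p=2$, $e=1$ and $m\ge 3$. (If $A$ is finite, the intersection is $\mathrm{PAut}(A)$.) 2) Let $A$ be critical and $A=D\oplus B$ with $D=D(A)$. Put $\Sigma:=\mathrm{St}(A,D)$, $\Delta:=\{1\oplus n\mid n\in\mathbb Z\setminus p\mathbb Z\}$, $\Phi:=\{1\oplus\varphi_0\mid\varphi_0\in\mathrm{FAut}(B)\}$ and $\Psi:=\{1\oplus\gamma_0\mid\gamma_0\in\mathrm{IAut}(B)\}$. Then these are subgroups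 of $\mathrm{Aut}(A)$, the product $\mathrm{FAut}(A)\cdot\Delta$ is a subgroup, and $$\mathrm{IAut}(A)=\mathrm{PAut}(A)\times(\mathrm{FAut}(A)\cdot\Delta),\qquad \mathrm{FAut}(A)\cdot\Delta=C_{\mathrm{IAut}(A)}(D)=\Sigma\rtimes\Psi,\qquad \mathrm{FAut}(A)=\Sigma\rtimes\Phi .$$ Moreover: i) $\Sigma$ is an infinite abelian $p$-group, $\exp(\Sigma)=\exp(B)=:m'<\infty$ and $\mathrm{eexp}(\Sigma)=\mathrm{eexp}(B)=:e'<\infty$; ii) $\Psi=\Phi\Delta\simeq\mathrm{IAut}(B)$, $[\Phi,\Delta]=1$, and $\Psi$ induces via conjugation on $\Sigma$ inertial automorphisms, this action being faithful; iii) $\Delta\simeq\mathrm{PAut}(B)\simeq\mathcal U(\mathbb Z/p^{m'}\mathbb Z)$; for each integer $n$ prime to $p$, the element $\delta_n:=1\oplus n$ of $\Delta$ satisfies $\delta_n^{-1}\circ\sigma\circ\delta_n=\sigma^{n}$ for all $\sigma\in\Sigma$, that is, $\delta_n$ acts via conjugation on $\Sigma$ as the multiplication by the inverse of $n$ modulo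 $p^{m'}$: $\delta_n\circ\sigma\circ\delta_n^{-1}=\sigma^{k}$ whenever $nk\equiv1\pmod{p^{m'}}$; and $\mathrm{FAut}(A)\cap\Delta$ has order $p^{m'-e'}$; iv) $\Phi\simeq\mathrm{FAut}(B)$, and $\Phi$ induces via conjugation on $\Sigma$ finitary automorphisms. -/

import Mathlib

/-!
Groups are written multiplicatively throughout, so that abelian groups are `CommGroup`s, the
multiplication by an integer `n` is `a ↦ a ^ n`, and automorphism groups are Mathlib's `MulAut G`,
in which `f * g` is the composite `x ↦ f (g x)`.
-/

open scoped Pointwise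

namespace InertialAut

section AutGroups

variable {G : Type*} [Group G]

/-- An automorphism `γ` is inertial if every subgroup `H` has finite index in the subgroup
generated by `H` and its image `H γ`. -/
def IsInertial (γ : MulAut G) : Prop :=
  ∀ H : Subgroup G, H.IsFiniteRelIndex (H ⊔ H.map γ.toMonoidHom)

/-- An automorphism is finitary if it is the identity on a subgroup of finite index. -/
def IsFinitary (γ : MulAut G) : Prop :=
  ∃ H : Subgroup G, H.FiniteIndex ∧ ∀ a ∈ H, γ a = a

/-- An automorphism is a power automorphism if it leaves every subgroup invariant. -/
def IsPower (γ : MulAut G) : Prop :=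
  ∀ H : Subgroup G, H.map γ.toMonoidHom = H

variable (G)

/-- The group generated by the inertial automorphisms. -/
def IAut : Subgroup (MulAut G) := Subgroup.closure {γ | IsInertial γ}

/-- The group of finitary automorphisms. -/
def FAut : Subgroup (MulAut G) where
  carrier := {γ | IsFinitary γ}
  one_mem' := ⟨⊤, inferInstance, fun _ _ => rfl⟩
  mul_mem' := by
    rintro f g ⟨H, hH, hf⟩ ⟨K, hK, hg⟩
    refine ⟨H ⊓ K, inferInstance, fun a ha => ?_⟩
    rw [MulAut.mul_apply, hg a ha.2, hf a ha.1]
  inv_mem' := by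
    rintro f ⟨H, hH, hf⟩
    refine ⟨H, hH, fun a ha => ?_⟩
    conv_lhs => rw [← hf a ha]
    exact MulAut.inv_apply_self G f a

/-- The group of power automorphisms. -/
def PAut : Subgroup (MulAut G) where
  carrier := {γ | IsPower γ}
  one_mem' := fun H => Subgroup.map_id H
  mul_mem' := by
    intro f g hf hg H
    have h : (f * g).toMonoidHom = f.toMonoidHom.comp g.toMonoidHom := rfl
    rw [h, ← Subgroup.map_map, hg H, hf H]
  inv_mem' := by
    intro f hf H
    have h : (f⁻¹).toMonoidHom.comp f.toMonoidHom = MonoidHom.id G := by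
      ext a
      exact MulAut.inv_apply_self G f a
    conv_lhs => rw [← hf H]
    rw [Subgroup.map_map, h, Subgroup.map_id]

variable {G}

/-- The centralizer of `X` in a group `Γ` of automorphisms. -/
def fixer (Γ : Subgroup (MulAut G)) (X : Subgroup G) : Subgroup (MulAut G) where
  carrier := {γ | γ ∈ Γ ∧ ∀ x ∈ X, γ x = x}
  one_mem' := ⟨Γ.one_mem, fun _ _ => rfl⟩
  mul_mem' := by
    rintro f g ⟨hf, hf'⟩ ⟨hg, hg'⟩
    refine ⟨Γ.mul_mem hf hg, fun x hx => ?_⟩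
    rw [MulAut.mul_apply, hg' x hx, hf' x hx]
  inv_mem' := by
    rintro f ⟨hf, hf'⟩
    refine ⟨Γ.inv_mem hf, fun x hx => ?_⟩
    conv_lhs => rw [← hf' x hx]
    exact MulAut.inv_apply_self G f x

/-- The stability group of the series `G ≥ X ≥ 1`: the automorphisms acting trivially on `X` and
on the cosets of `X`. -/
def St (X : Subgroup G) : Subgroup (MulAut G) where
  carrier := {σ | (∀ a, a⁻¹ * σ a ∈ X) ∧ ∀ x ∈ X, σ x = x}
  one_mem' := ⟨fun a => by simp, fun _ _ => rfl⟩
  mul_mem' := by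
    rintro f g ⟨hf, hf'⟩ ⟨hg, hg'⟩
    refine ⟨fun a => ?_, fun x hx => ?_⟩
    · have h := X.mul_mem (hg a) (hf (g a))
      simpa [mul_assoc] using h
    · rw [MulAut.mul_apply, hg' x hx, hf' x hx]
  inv_mem' := by
    rintro f ⟨hf, hf'⟩
    refine ⟨fun a => ?_, fun x hx => ?_⟩
    · have h := X.inv_mem (hf (f⁻¹ a))
      simpa using h
    · conv_lhs => rw [← hf' x hx]
      exact MulAut.inv_apply_self G f x

/-- `exp(G) = m`: the smallest `m` such that `g ^ (p ^ m) = 1` for all `g`; it is `⊤` if there is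
none. -/
noncomputable def pExp (p : ℕ) (G : Type*) [Group G] : ℕ∞ :=
  sInf ((fun m : ℕ => (m : ℕ∞)) '' {m | ∀ g : G, g ^ p ^ m = 1})

/-- The essential exponent `eexp(G) = e`: the smallest `e` such that there are only finitely many
powers `g ^ (p ^ e)`; it is `⊤` if there is none. -/
noncomputable def eExp (p : ℕ) (G : Type*) [Group G] : ℕ∞ :=
  sInf ((fun e : ℕ => (e : ℕ∞)) '' {e | (Set.range fun g : G => g ^ p ^ e).Finite})

/-- `L` is the internal direct product of its subgroups `H` and `K`. -/
def IsInternalDirect (H K L : Subgroup G) : Prop :=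
  (∀ h ∈ H, ∀ k ∈ K, h * k = k * h) ∧ H ⊓ K = ⊥ ∧ (L : Set G) = (H : Set G) * (K : Set G)

/-- `L` is the internal semidirect product `N ⋊ K` of its normal subgroup `N` and its
subgroup `K`. -/
def IsInternalSemidirect (N K L : Subgroup G) : Prop :=
  (∀ l ∈ L, ∀ n ∈ N, l * n * l⁻¹ ∈ N) ∧ N ⊓ K = ⊥ ∧ (L : Set G) = (N : Set G) * (K : Set G)

end AutGroups

section Abelian

variable {A : Type*} [CommGroup A]

/-- The subgroup `H` is a divisible group. -/
def IsDivisible (H : Subgroup A) : Prop :=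
  ∀ n : ℕ, n ≠ 0 → ∀ x ∈ H, ∃ y ∈ H, y ^ n = x

/-- The subgroup `H` has finite rank: there is a bound on the number of elements of an independent
system of nontrivial elements of `H`, where a system is independent if a relation
`∏ a ^ (c a) = 1` between its elements holds only if every factor `a ^ (c a)` is trivial. -/
def HasFiniteRank (H : Subgroup A) : Prop :=
  ∃ r : ℕ, ∀ s : Finset A, (∀ a ∈ s, a ∈ H ∧ a ≠ 1) →
    (∀ c : A → ℤ, ∏ a ∈ s, a ^ c a = 1 → ∀ a ∈ s, a ^ c a = 1) → s.card ≤ r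

/-- The subgroup `H` is bounded. -/
def IsBddExponent (H : Subgroup A) : Prop :=
  ∃ n : ℕ, n ≠ 0 ∧ ∀ x ∈ H, x ^ n = 1

variable (A)

/-- The divisible part `D(A)`: the largest divisible subgroup of `A`. -/
def divPart : Subgroup A := sSup {H | IsDivisible H}

/-- `A` is critical: it is the direct product of a nontrivial divisible subgroup of finite rank and
an infinite bounded subgroup. -/
def IsCritical : Prop :=
  ∃ D B : Subgroup A, IsCompl D B ∧ D ≠ ⊥ ∧ IsDivisible D ∧ HasFiniteRank D ∧
    Infinite B ∧ IsBddExponent B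

theorem isDivisible_divPart : IsDivisible (divPart A) := by
  intro n hn x hx
  suffices h : divPart A ≤ (divPart A).map (powMonoidHom n) by
    obtain ⟨y, hy, hyx⟩ := h hx
    exact ⟨y, hy, hyx⟩
  refine sSup_le fun H hH x hx => ?_
  obtain ⟨y, hy, hyx⟩ := hH n hn x hx
  exact ⟨y, le_sSup (a := H) hH hy, hyx⟩

theorem isGreatest_divPart : IsGreatest {H : Subgroup A | IsDivisible H} (divPart A) :=
  ⟨isDivisible_divPart A, fun _ hH => le_sSup hH⟩

variable {A}

theorem apply_mem_divPart (γ : MulAut A) {x : A} (hx : x ∈ divPart A) : γ x ∈ divPart A := by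
  have h : IsDivisible ((divPart A).map γ.toMonoidHom) := by
    rintro n hn _ ⟨z, hz, rfl⟩
    obtain ⟨y, hy, rfl⟩ := isDivisible_divPart A n hn z hz
    exact ⟨γ y, ⟨y, hy, rfl⟩, (map_pow γ y n).symm⟩
  exact (isGreatest_divPart A).2 h ⟨x, hx, rfl⟩

instance normal_St_divPart : (St (divPart A)).Normal where
  conj_mem := by
    rintro σ ⟨h1, h2⟩ γ
    refine ⟨fun a => ?_, fun x hx => ?_⟩
    · have h := apply_mem_divPart γ (h1 (γ⁻¹ a))
      simpa using h
    · have h := h2 _ (apply_mem_divPart γ⁻¹ hx)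
      rw [MulAut.mul_apply, MulAut.mul_apply, h]
      exact MulAut.apply_inv_self A γ x

/-- The automorphism `σ ↦ γ ∘ σ ∘ γ⁻¹` of the stability group `St(A, D(A))` induced by `γ` via
conjugation. -/
def conjSt (γ : MulAut A) : MulAut (St (divPart A)) := MulAut.conjNormal γ

/-- A group `A` that is the direct product of `D` and `B` is isomorphic to `D × B`. -/
noncomputable def prodEquiv {D B : Subgroup A} (h : IsCompl D B) : (D × B) ≃* A :=
  MulEquiv.ofBijective (D.subtype.coprod B.subtype) <| by
    constructor
    · rw [injective_iff_map_eq_one]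
      rintro ⟨⟨d, hd⟩, ⟨b, hb⟩⟩ hdb
      have hdb' : d * b = 1 := hdb
      have hdB : d ∈ B := by
        rw [eq_inv_of_mul_eq_one_left hdb']
        exact B.inv_mem hb
      have h1 : d = 1 := (Subgroup.mem_bot).1 (h.disjoint.le_bot ⟨hd, hdB⟩)
      subst h1
      simp only [one_mul] at hdb'
      subst hdb'
      rfl
    · intro a
      have ha : a ∈ D ⊔ B := by rw [h.sup_eq_top]; trivial
      obtain ⟨d, hd, b, hb, rfl⟩ := Subgroup.mem_sup.1 ha
      exact ⟨(⟨d, hd⟩, ⟨b, hb⟩), rfl⟩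

/-- For `A = D ⊕ B`, the embedding `γ₀ ↦ 1 ⊕ γ₀` of `Aut(B)` in `Aut(A)`. -/
noncomputable def oneSum {D B : Subgroup A} (h : IsCompl D B) : MulAut B →* MulAut A where
  toFun γ₀ := (prodEquiv h).symm.trans
    ((MulEquiv.prodCongr (MulEquiv.refl D) γ₀).trans (prodEquiv h))
  map_one' := by
    ext a
    exact (prodEquiv h).apply_symm_apply a
  map_mul' f g := by
    ext a
    simp only [MulEquiv.trans_apply, MulAut.mul_apply, MulEquiv.symm_apply_apply]
    rfl

theorem oneSum_apply {D B : Subgroup A} (h : IsCompl D B) (γ₀ : MulAut B) (d : D) (b : B) :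
    oneSum h γ₀ (d * b) = d * γ₀ b := by
  have hdb : (d * b : A) = prodEquiv h (d, b) := rfl
  rw [hdb]
  simp only [oneSum, MonoidHom.coe_mk, OneHom.coe_mk, MulEquiv.trans_apply,
    MulEquiv.symm_apply_apply]
  rfl

/-- For `A = D ⊕ B`, the automorphism `δ` is `1 ⊕ n`: the identity on `D` and the multiplication
by `n` on `B`. -/
def IsOneSumInt (D B : Subgroup A) (n : ℤ) (δ : MulAut A) : Prop :=
  ∀ d ∈ D, ∀ b ∈ B, δ (d * b) = d * b ^ n

end Abelian

end InertialAut

/-! Passing to endomorphisms, `γ` is inertial exactly when `γ(H)` has finite image modulo `H` for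
every `H`, and this does not change if `γ` is replaced by `γ - 1` (in additive language). Two facts
about inertial endomorphisms carry the proof. First, such a `φ` maps each cyclic subgroup of some
`H` into itself, where `A/H` has finite socle (`IsInertEnd.exists_subgroup`), and the same holds on
every divisible subgroup (`IsInertEnd.mem_zpowers_of_isDivisible`). A homomorphism with this
property is multiplication by a `p`-adic integer (`exists_isCompatible`). Second, an inertial `φ`
vanishing on a nonzero divisible subgroup is bounded (`IsInertEnd.exists_pow_eq_one`).

In the non-critical case one divides `γ` by a power automorphism `α` that agrees with it on `D`, or
on `H` if `D = 0`. The difference of `α⁻¹γ` and the identity then has finite image: in general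
because this image has finite socle and is reduced or bounded; in the remaining case `D` has finite
rank and its complement is bounded, hence finite as `A` is not critical. For bounded `A` the
intersection of `PAut` and `FAut` is the kernel of `(ℤ/p^m)ˣ → (ℤ/p^e)ˣ`.

In the critical case, after division by `α`, an inertial automorphism fixes `D` pointwise and
factors as an element of the stability group times `1 ⊕ γ₀` with `γ₀` inertial on the bounded group
`B`, to which the non-critical case applies. The stability group is `Hom(B, D)`, on which `1 ⊕ γ₀`
acts by precomposition with `γ₀⁻¹`. Since `D` has finite socle and homomorphisms into `D` separate
the points of `B` (`exists_hom_apply_ne_one`), exponents, finiteness and faithfulness pass between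
`B` and `Hom(B, D)`. -/

namespace InertialAut

set_option linter.unusedSectionVars false

/-! ### Abelian `p`-groups with finite socle, and divisible subgroups -/

section Socle

variable {p : ℕ} [Fact p.Prime] {A C : Type*} [CommGroup A] [CommGroup C]

theorem finite_closure (hA : IsPGroup p A) {s : Set A} (hs : s.Finite) :
    Finite (Subgroup.closure s) := by
  have : Group.FG (Subgroup.closure s) := by
    rw [Group.fg_iff_subgroup_fg]
    exact (Subgroup.fg_iff _).2 ⟨s, rfl, hs⟩
  refine CommGroup.finite_of_fg_isMulTorsion _ fun g => ?_
  obtain ⟨k, hk⟩ := hA.to_subgroup _ g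
  exact isOfFinOrder_iff_pow_eq_one.2 ⟨p ^ k, pow_pos (Fact.out : p.Prime).pos k, hk⟩

/-- The elements of order dividing `p` form a finite set. -/
def HasFiniteSocle (p : ℕ) (G : Type*) [Group G] : Prop := {g : G | g ^ p = 1}.Finite

theorem HasFiniteSocle.of_injective {f : C →* A} (hf : Function.Injective f)
    (h : HasFiniteSocle p A) : HasFiniteSocle p C :=
  (h.preimage (f := f) hf.injOn).subset fun x (hx : x ^ p = 1) => by
    show (f x) ^ p = 1
    rw [← map_pow, hx, map_one]

theorem HasFiniteSocle.prod (hA : HasFiniteSocle p A) (hC : HasFiniteSocle p C) :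
    HasFiniteSocle p (A × C) :=
  (Set.Finite.prod hA hC).subset fun x (hx : x ^ p = 1) =>
    ⟨congrArg Prod.fst hx, congrArg Prod.snd hx⟩

/-- Lift finitely many socle elements of `C` to a finite subgroup `Z` of `A`. Their span is a
quotient of `Z/Z^p`, which for finite `Z` has as many elements as the socle of `Z`. So the socle of
`C` is no larger than that of `A`. -/
theorem HasFiniteSocle.of_surjective (hA : IsPGroup p A) {f : A →* C}
    (hf : Function.Surjective f) (h : HasFiniteSocle p A) : HasFiniteSocle p C := by
  classical
  by_contra hinf
  obtain ⟨T, hT, hcard⟩ := Set.Infinite.exists_subset_card_eq hinf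
    ({g : A | g ^ p = 1}.ncard + 1)
  set Z : Subgroup A := Subgroup.closure (Function.surjInv hf '' (T : Set C)) with hZ
  have : Finite Z := finite_closure hA (T.finite_toSet.image _)
  set g : Z →* C := f.comp Z.subtype with hg
  have hmap : Z.map f = Subgroup.closure (T : Set C) := by
    rw [hZ, MonoidHom.map_closure, ← Set.image_comp]
    congr 1
    convert Set.image_id _
    exact funext (Function.surjInv_eq hf)
  have hker : (powMonoidHom p : Z →* Z).range ≤ g.ker := by
    rintro _ ⟨z, rfl⟩
    have hz : f z ∈ Subgroup.closure (T : Set C) := hmap ▸ ⟨z, z.2, rfl⟩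
    have hle : Subgroup.closure (T : Set C) ≤ (powMonoidHom p : C →* C).ker := by
      rw [Subgroup.closure_le]
      exact fun x hx => hT hx
    have : (f z) ^ p = 1 := hle hz
    rw [MonoidHom.mem_ker]
    simpa [hg] using this
  have h1 : Nat.card g.range ≤ Nat.card (powMonoidHom p : Z →* Z).ker := by
    rw [← Subgroup.index_ker, ← Subgroup.index_range]
    exact Nat.le_of_dvd (Nat.pos_of_ne_zero Subgroup.FiniteIndex.index_ne_zero)
      (Subgroup.index_dvd_of_le hker)
  have h2 : Nat.card (powMonoidHom p : Z →* Z).ker ≤ {g : A | g ^ p = 1}.ncard := by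
    rw [← Nat.card_coe_set_eq]
    have : Finite {g : A | g ^ p = 1} := h
    refine Nat.card_le_card_of_injective
      (fun z => ⟨(z : Z), by
        have := z.2
        rw [MonoidHom.mem_ker] at this
        exact congrArg Subtype.val this⟩) ?_
    intro a b hab
    have h' := Subtype.ext_iff.1 hab
    exact Subtype.ext (Subtype.ext h')
  have h3 : T.card ≤ Nat.card g.range := by
    rw [← Nat.card_eq_finsetCard T]
    have : Finite g.range := Set.finite_range g
    refine Nat.card_le_card_of_injective (β := g.range) (fun t => ⟨t, ?_⟩) ?_
    · have : (t : C) ∈ Z.map f := hmap ▸ Subgroup.subset_closure t.2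
      obtain ⟨z, hz, hzt⟩ := this
      exact ⟨⟨z, hz⟩, hzt⟩
    · intro a b hab
      have h' := Subtype.ext_iff.1 hab
      exact Subtype.ext h'
  omega

theorem HasFiniteSocle.finite_pow_eq_one (h : HasFiniteSocle p A) (k : ℕ) :
    {a : A | a ^ p ^ k = 1}.Finite := by
  induction k with
  | zero => simp
  | succ k ih =>
    refine (Set.Finite.biUnion ih (t := fun b => {a : A | a ^ p = b}) fun b _ => ?_).subset ?_
    · rcases Set.eq_empty_or_nonempty {a : A | a ^ p = b} with h0 | ⟨a₀, ha₀⟩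
      · rw [h0]; exact Set.finite_empty
      · refine (h.image (a₀ * ·)).subset fun a ha => ⟨a₀⁻¹ * a, ?_, by simp⟩
        show (a₀⁻¹ * a) ^ p = 1
        rw [mul_pow, inv_pow, show a₀ ^ p = b from ha₀, show a ^ p = b from ha]
        simp
    · intro a ha
      simp only [Set.mem_iUnion]
      refine ⟨a ^ p, ?_, rfl⟩
      show (a ^ p) ^ p ^ k = 1
      rw [← pow_mul, ← pow_succ']
      exact ha

theorem HasFiniteSocle.finite_of_pow_eq_one (h : HasFiniteSocle p A) {k : ℕ}
    (hk : ∀ a : A, a ^ p ^ k = 1) : Finite A :=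
  Set.finite_univ_iff.1 ((h.finite_pow_eq_one k).subset fun a _ => hk a)

theorem isDivisible_of_prime (hA : IsPGroup p A) {H : Subgroup A}
    (h : ∀ x ∈ H, ∃ y ∈ H, y ^ p = x) : IsDivisible H := by
  have hpk : ∀ k : ℕ, ∀ x ∈ H, ∃ y ∈ H, y ^ p ^ k = x := by
    intro k
    induction k with
    | zero => exact fun x hx => ⟨x, hx, by simp⟩
    | succ k ih =>
      intro x hx
      obtain ⟨y, hy, rfl⟩ := ih x hx
      obtain ⟨z, hz, rfl⟩ := h y hy
      exact ⟨z, hz, by rw [← pow_mul, ← pow_succ']⟩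
  intro n hn x hx
  obtain ⟨k, m, hm, rfl⟩ := Nat.exists_eq_pow_mul_and_not_dvd hn p (Fact.out : p.Prime).ne_one
  have hcop : p.Coprime m := (Nat.Prime.coprime_iff_not_dvd Fact.out).2 hm
  obtain ⟨z, hz⟩ := ((hA.to_subgroup H).powEquiv hcop).surjective ⟨x, hx⟩
  have hz' : (z : A) ^ m = x := congrArg Subtype.val hz
  obtain ⟨y, hy, hyz⟩ := hpk k z z.2
  exact ⟨y, hy, by rw [pow_mul, hyz, hz']⟩

/-- A `p`-group with a finite socle and without nontrivial divisible subgroups is finite. -/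
theorem HasFiniteSocle.finite_of_reduced (hA : IsPGroup p A) (h : HasFiniteSocle p A)
    (hred : ∀ H : Subgroup A, IsDivisible H → H = ⊥) : Finite A := by
  -- The part of the socle lying in `A^(p^k)` decreases with `k` and is finite, so it becomes
  -- stationary; from that `k` on, `A^(p^k)` is divisible.
  set P : ℕ → Set A := fun k => {a | a ^ p = 1 ∧ ∃ b : A, b ^ p ^ k = a} with hP
  have hanti : Antitone P := by
    refine antitone_nat_of_succ_le fun k => ?_
    rintro a ⟨ha, b, rfl⟩
    exact ⟨ha, b ^ p, by rw [← pow_mul, ← pow_succ']⟩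
  have hfin : ∀ k, (P k).Finite := fun k => h.subset fun a ha => ha.1
  obtain ⟨k, hk⟩ : ∃ k, ∀ j, k ≤ j → P k = P j := by
    set S : Set ℕ := Set.range fun k => (P k).ncard
    obtain ⟨k, hk⟩ : sInf S ∈ S := Nat.sInf_mem ⟨_, 0, rfl⟩
    refine ⟨k, fun j hj => ?_⟩
    refine (Set.eq_of_subset_of_ncard_le (hanti hj) ?_ (hfin k)).symm
    have : sInf S ≤ (P j).ncard := Nat.sInf_le ⟨j, rfl⟩
    exact hk.trans_le this
  have hdiv : IsDivisible (powMonoidHom (p ^ k) : A →* A).range := by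
    refine isDivisible_of_prime hA ?_
    have key : ∀ n : ℕ, ∀ y ∈ (powMonoidHom (p ^ k) : A →* A).range, y ^ p ^ n = 1 →
        ∃ z ∈ (powMonoidHom (p ^ k) : A →* A).range, z ^ p = y := by
      intro n
      induction n with
      | zero => exact fun y _ hy1 => ⟨1, one_mem _, by simpa using hy1.symm⟩
      | succ n ih =>
        rintro y ⟨b, rfl⟩ hy1
        -- By stationarity this socle element is also a `p ^ (k + n + 1)`-th power of some `c`.
        -- Dividing `y` by the `p`-th power of `c ^ p ^ k` lowers its order, and induction gives a
        -- `p`-th root.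
        have hmem : (powMonoidHom (p ^ k) b) ^ p ^ n ∈ P k := by
          refine ⟨by rw [← pow_mul, ← pow_succ]; exact hy1, b ^ p ^ n, ?_⟩
          simp only [powMonoidHom_apply, ← pow_mul, mul_comm]
        rw [hk (k + (n + 1)) (by omega)] at hmem
        obtain ⟨-, c, hc⟩ := hmem
        obtain ⟨z, hz, hz'⟩ := ih (powMonoidHom (p ^ k) b * ((c ^ p ^ k) ^ p)⁻¹)
          (mul_mem ⟨b, rfl⟩ (inv_mem (pow_mem (MonoidHom.mem_range.2 ⟨c, rfl⟩) _))) (by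
            rw [mul_pow, ← hc, inv_pow]
            simp only [← pow_mul]
            rw [pow_add, pow_succ', ← mul_assoc, mul_inv_cancel])
        refine ⟨z * c ^ p ^ k, mul_mem hz ⟨c, rfl⟩, ?_⟩
        rw [mul_pow, hz']
        simp
    intro x hx
    obtain ⟨n, hn⟩ := hA x
    exact key n x hx hn
  have hbot := hred _ hdiv
  refine h.finite_of_pow_eq_one (k := k) fun a => ?_
  have : a ^ p ^ k ∈ (powMonoidHom (p ^ k) : A →* A).range := ⟨a, rfl⟩
  rwa [hbot, Subgroup.mem_bot] at this

theorem isDivisible_map {H : Subgroup A} (hH : IsDivisible H) (f : A →* C) :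
    IsDivisible (H.map f) := by
  rintro n hn _ ⟨x, hx, rfl⟩
  obtain ⟨y, hy, rfl⟩ := hH n hn x hx
  exact ⟨f y, ⟨y, hy, rfl⟩, (map_pow f y n).symm⟩

theorem eq_bot_of_isDivisible_of_pow_eq_one {H : Subgroup A} (hH : IsDivisible H) {n : ℕ}
    (hn : n ≠ 0) (h : ∀ x ∈ H, x ^ n = 1) : H = ⊥ := by
  rw [eq_bot_iff]
  intro x hx
  obtain ⟨y, hy, rfl⟩ := hH n hn x hx
  exact Subgroup.mem_bot.2 (h y hy)

theorem eq_bot_of_isDivisible_subgroup {X : Subgroup A} (hX : Disjoint (divPart A) X)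
    {H : Subgroup X} (hH : IsDivisible H) : H = ⊥ := by
  have h1 : H.map X.subtype ≤ divPart A := (isGreatest_divPart A).2 (isDivisible_map hH _)
  have h2 : H.map X.subtype ≤ X := Subgroup.map_subtype_le H
  have h3 : H.map X.subtype = ⊥ := eq_bot_iff.2 (hX h1 h2)
  exact (Subgroup.map_eq_bot_iff_of_injective H X.subtype_injective).1 h3

end Socle

/-! ### Complements of divisible subgroups, separation of points, finite rank -/

section Complements

variable {p : ℕ} [Fact p.Prime] {A B : Type*} [CommGroup A] [CommGroup B]

theorem zpow_mem_of_isCoprime {H : Subgroup A} {a : A} {k l : ℤ} (hkl : IsCoprime k l)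
    (hk : a ^ k ∈ H) (hl : a ^ l ∈ H) : a ∈ H := by
  obtain ⟨u, v, huv⟩ := hkl
  have : a = (a ^ k) ^ u * (a ^ l) ^ v := by
    rw [← zpow_mul, ← zpow_mul, ← zpow_add, mul_comm k, mul_comm l, huv, zpow_one]
  rw [this]
  exact mul_mem (zpow_mem hk _) (zpow_mem hl _)

theorem exists_maximal_disjoint {W D : Subgroup A} (h : Disjoint W D) :
    ∃ H, W ≤ H ∧ Maximal (fun H : Subgroup A => Disjoint H D) H := by
  refine zorn_le_nonempty₀ {H : Subgroup A | Disjoint H D} ?_ W h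
  intro c hc hchain y hy
  refine ⟨sSup c, ?_, fun z hz => le_sSup hz⟩
  show Disjoint (sSup c) D
  rw [Subgroup.disjoint_def]
  intro x hx hxD
  rw [Subgroup.mem_sSup_of_directedOn ⟨y, hy⟩ hchain.directedOn] at hx
  obtain ⟨H, hH, hxH⟩ := hx
  exact Subgroup.disjoint_def.1 (hc hH) hxH hxD

/-- A subgroup maximal among those meeting `D` trivially is a complement. If `b ^ p ∈ DH`,
divisibility lets one correct `b` by an element of `D` so that its `p`-th power lies in `H`; a
corrected element outside `DH` could be added to `H`, against maximality. -/
theorem exists_isCompl_of_isDivisible (hA : IsPGroup p A) {D W : Subgroup A}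
    (hD : IsDivisible D) (h : Disjoint W D) : ∃ H, W ≤ H ∧ IsCompl D H := by
  obtain ⟨H, hWH, hH, hmax⟩ := exists_maximal_disjoint h
  have hp : p.Prime := Fact.out
  refine ⟨H, hWH, hH.symm, codisjoint_iff.2 ?_⟩
  have key : ∀ n : ℕ, ∀ a : A, a ^ p ^ n ∈ D ⊔ H → a ∈ D ⊔ H := by
    intro n
    induction n with
    | zero => intro a ha; simpa using ha
    | succ n ih =>
      intro a ha
      rw [pow_succ, pow_mul] at ha
      suffices hs : ∀ b : A, b ^ p ∈ D ⊔ H → b ∈ D ⊔ H from ih a (hs _ ha)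
      intro b hb
      obtain ⟨d, hd, x, hx, hdx⟩ := Subgroup.mem_sup.1 hb
      obtain ⟨e, he, rfl⟩ := hD p hp.ne_zero d hd
      have hc : (b * e⁻¹) ^ p = x := by
        rw [mul_pow, ← hdx, inv_pow, mul_comm (e ^ p), mul_inv_cancel_right]
      suffices hs : b * e⁻¹ ∈ D ⊔ H by
        have := mul_mem hs (le_sup_left (b := H) he)
        rwa [inv_mul_cancel_right] at this
      set c := b * e⁻¹ with hcdef
      by_contra hcn
      have hdis : Disjoint (H ⊔ Subgroup.zpowers c) D := by
        rw [Subgroup.disjoint_def]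
        intro y hy hyD
        obtain ⟨z, hz, w, hw, rfl⟩ := Subgroup.mem_sup.1 hy
        obtain ⟨k, rfl⟩ := Subgroup.mem_zpowers_iff.1 hw
        have hcp : c ^ (p : ℤ) ∈ H := by rw [zpow_natCast, hc]; exact hx
        by_cases hk : (p : ℤ) ∣ k
        · obtain ⟨l, rfl⟩ := hk
          rw [zpow_mul] at hyD ⊢
          exact Subgroup.disjoint_def.1 hH (mul_mem hz (zpow_mem hcp l)) hyD
        · exfalso
          apply hcn
          have hcop : IsCoprime (p : ℤ) k :=
            ((Nat.prime_iff_prime_int.1 hp).coprime_iff_not_dvd).2 hk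
          refine zpow_mem_of_isCoprime hcop (le_sup_right (a := D) hcp) ?_
          have := mul_mem (le_sup_left (b := H) hyD) (le_sup_right (a := D) (inv_mem hz))
          rwa [mul_comm z, mul_inv_cancel_right] at this
      have hle : H ⊔ Subgroup.zpowers c ≤ H := hmax hdis le_sup_left
      exact hcn (le_sup_right (a := D) (hle (le_sup_right (a := H) (Subgroup.mem_zpowers c))))
  rw [eq_top_iff]
  intro a _
  obtain ⟨n, hn⟩ := hA a
  exact key n a (by rw [hn]; exact one_mem _)

theorem exists_isCompl_divPart (hA : IsPGroup p A) : ∃ B, IsCompl (divPart A) B := by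
  obtain ⟨B, -, hB⟩ := exists_isCompl_of_isDivisible hA (isDivisible_divPart A) disjoint_bot_left
  exact ⟨B, hB⟩

/-- For `H` maximal with trivial intersection with `F`, enlarging `H` by an element of order `p`
modulo `H` must meet `F`, so every socle element of `A/H` is represented in the finite set `F`. -/
theorem exists_disjoint_hasFiniteSocle (F : Subgroup A) [Finite F] :
    ∃ H : Subgroup A, Disjoint H F ∧ HasFiniteSocle p (A ⧸ H) := by
  obtain ⟨H, -, hH, hmax⟩ := exists_maximal_disjoint (disjoint_bot_left (a := F))
  have hp : p.Prime := Fact.out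
  refine ⟨H, hH, ?_⟩
  refine ((Set.toFinite (F : Set A)).image (QuotientGroup.mk : A → A ⧸ H)).subset ?_
  intro q hq
  obtain ⟨a, rfl⟩ := QuotientGroup.mk_surjective q
  have hap : a ^ p ∈ H := by
    rw [← QuotientGroup.eq_one_iff]
    exact hq
  by_cases ha : a ∈ H
  · exact ⟨1, F.one_mem, ((QuotientGroup.eq_one_iff a).2 ha).symm⟩
  have hnd : ¬ Disjoint (H ⊔ Subgroup.zpowers a) F := fun hd =>
    ha (hmax hd le_sup_left (le_sup_right (a := H) (Subgroup.mem_zpowers a)))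
  rw [Subgroup.disjoint_def] at hnd
  push Not at hnd
  obtain ⟨x, hx, hxF, hx1⟩ := hnd
  obtain ⟨z, hz, w, hw, rfl⟩ := Subgroup.mem_sup.1 hx
  obtain ⟨k, rfl⟩ := Subgroup.mem_zpowers_iff.1 hw
  have hcp : a ^ (p : ℤ) ∈ H := by rw [zpow_natCast]; exact hap
  by_cases hk : (p : ℤ) ∣ k
  · obtain ⟨l, rfl⟩ := hk
    rw [zpow_mul] at hxF hx1
    exact absurd (Subgroup.disjoint_def.1 hH (mul_mem hz (zpow_mem hcp l)) hxF) hx1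
  · have hcop : IsCoprime k (p : ℤ) :=
      (((Nat.prime_iff_prime_int.1 hp).coprime_iff_not_dvd).2 hk).symm
    obtain ⟨u, v, huv⟩ := hcop
    refine ⟨(z * a ^ k) ^ u, F.zpow_mem hxF u, ?_⟩
    rw [QuotientGroup.eq]
    have : ((z * a ^ k) ^ u)⁻¹ * a = (z ^ u)⁻¹ * (a ^ (p : ℤ)) ^ v := by
      rw [mul_zpow, mul_inv, mul_assoc, ← zpow_mul, ← zpow_mul]
      congr 1
      rw [inv_mul_eq_iff_eq_mul, ← zpow_add, mul_comm k, mul_comm (p : ℤ), huv, zpow_one]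
    rw [this]
    exact mul_mem (inv_mem (zpow_mem hz u)) (zpow_mem hcp v)

theorem exists_pow_eq_one_of_ne_bot (hA : IsPGroup p A) {D : Subgroup A} (hD : D ≠ ⊥) :
    ∃ d ∈ D, d ≠ 1 ∧ d ^ p = 1 := by
  obtain ⟨⟨x, hx⟩, hx1⟩ := Subgroup.ne_bot_iff_exists_ne_one.1 hD
  have hex := hA x
  classical
  have hne : Nat.find hex ≠ 0 := fun h0 => by
    have := Nat.find_spec hex
    rw [h0, pow_zero, pow_one] at this
    exact hx1 (Subtype.ext this)
  obtain ⟨n, hn⟩ := Nat.exists_eq_succ_of_ne_zero hne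
  refine ⟨x ^ p ^ n, pow_mem hx _, Nat.find_min hex (by omega), ?_⟩
  rw [← pow_mul, ← pow_succ, ← Nat.succ_eq_add_one, ← hn]
  exact Nat.find_spec hex

theorem exists_orderOf_eq_of_isDivisible (hA : IsPGroup p A) {D : Subgroup A} (hD : IsDivisible D)
    (hne : D ≠ ⊥) (n : ℕ) : ∃ d ∈ D, orderOf d = p ^ n := by
  have hp : p.Prime := Fact.out
  obtain ⟨x, hx, hx1, hxp⟩ := exists_pow_eq_one_of_ne_bot hA hne
  cases n with
  | zero => exact ⟨1, D.one_mem, by simp⟩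
  | succ n =>
    obtain ⟨y, hy, rfl⟩ := hD (p ^ n) (pow_ne_zero _ hp.ne_zero) x hx
    exact ⟨y, hy, orderOf_eq_prime_pow hx1 (by rw [pow_succ, pow_mul, hxp])⟩

/-- Homomorphisms into a nontrivial divisible `p`-group separate the points of a `p`-group. -/
theorem exists_hom_apply_ne_one (hA : IsPGroup p A) (hB : IsPGroup p B) {D : Subgroup A}
    (hD : IsDivisible D) (hne : D ≠ ⊥) {b : B} (hb : b ≠ 1) : ∃ f : B →* D, f b ≠ 1 := by
  have hp : p.Prime := Fact.out
  obtain ⟨b', hb', hb1, hbp⟩ : ∃ b' ∈ Subgroup.zpowers b, b' ≠ 1 ∧ b' ^ p = 1 :=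
    exists_pow_eq_one_of_ne_bot hB (by simpa using hb)
  obtain ⟨d, hd, hd1, hdp⟩ := exists_pow_eq_one_of_ne_bot hA hne
  have hBD : IsPGroup p (B × D) := by
    rintro ⟨x, y⟩
    obtain ⟨k, hk⟩ := hB x
    obtain ⟨l, hl⟩ := hA.to_subgroup D y
    refine ⟨k + l, Prod.ext ?_ ?_⟩
    · show x ^ p ^ (k + l) = 1
      rw [pow_add, pow_mul, hk, one_pow]
    · show y ^ p ^ (k + l) = 1
      rw [pow_add, mul_comm, pow_mul, hl, one_pow]
  set E : Subgroup (B × D) := (MonoidHom.inr B D).range with hE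
  have hEdiv : IsDivisible E := by
    rintro n hn _ ⟨⟨x, hx⟩, rfl⟩
    obtain ⟨y, hy, hyx⟩ := hD n hn x hx
    refine ⟨MonoidHom.inr B D ⟨y, hy⟩, ⟨_, rfl⟩, ?_⟩
    rw [← map_pow]
    exact congrArg _ (Subtype.ext hyx)
  -- The diagonal of two elements of order `p` meets `1 × D` trivially, so it lies in some
  -- complement of `1 × D`. Projecting to `D` along that complement sends `(b', 1)` to `d⁻¹ ≠ 1`.
  have hdis : Disjoint (Subgroup.zpowers ((b', ⟨d, hd⟩) : B × D)) E := by
    rw [Subgroup.disjoint_def]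
    rintro x hx ⟨y, rfl⟩
    obtain ⟨k, hk⟩ := Subgroup.mem_zpowers_iff.1 hx
    have h1 : b' ^ k = 1 := congrArg Prod.fst hk
    have h2 : (⟨d, hd⟩ : D) ^ k = y := congrArg Prod.snd hk
    have hpk : (p : ℤ) ∣ k := by
      rw [← orderOf_eq_prime hbp hb1]
      exact orderOf_dvd_iff_zpow_eq_one.2 h1
    obtain ⟨l, rfl⟩ := hpk
    have h3 : y = 1 := by
      rw [← h2, zpow_mul, zpow_natCast]
      have : (⟨d, hd⟩ : D) ^ p = 1 := Subtype.ext hdp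
      rw [this, one_zpow]
    rw [h3, map_one]
  obtain ⟨H, hWH, hH⟩ := exists_isCompl_of_isDivisible hBD hEdiv hdis
  set π : B × D →* D := (MonoidHom.snd B D).comp (E.subtype.comp ((MonoidHom.fst E H).comp
    (prodEquiv hH).symm.toMonoidHom)) with hπ
  have hπ' : ∀ (e : E) (h : H), π (e * h) = (e : B × D).2 := by
    intro e h
    have : ((e : B × D) * h) = prodEquiv hH (e, h) := rfl
    rw [this]
    simp [hπ]
  refine ⟨π.comp (MonoidHom.inl B D), fun h1 => hd1 ?_⟩
  obtain ⟨k, hk⟩ := Subgroup.mem_zpowers_iff.1 hb'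
  have h2 : π (b', 1) = 1 := by
    have : π.comp (MonoidHom.inl B D) b' = 1 := by rw [← hk, map_zpow, h1, one_zpow]
    exact this
  have h3 := hπ' ⟨MonoidHom.inr B D (⟨d, hd⟩⁻¹), ⟨_, rfl⟩⟩
    ⟨(b', ⟨d, hd⟩), hWH (Subgroup.mem_zpowers _)⟩
  have h4 : (MonoidHom.inr B D (⟨d, hd⟩⁻¹)) * ((b', ⟨d, hd⟩) : B × D) = (b', 1) := by
    simp [MonoidHom.inr_apply]
  simp only [h4, h2] at h3
  have h5 : (⟨d, hd⟩ : D)⁻¹ = 1 := h3.symm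
  exact congrArg Subtype.val (inv_eq_one.1 h5)

/-- A largest independent system of elements of order `p` spans the socle. Conversely, replacing the
members of an independent system by powers of order `p` embeds it into the socle. -/
theorem hasFiniteRank_iff_hasFiniteSocle (hA : IsPGroup p A) (D : Subgroup A) :
    HasFiniteRank D ↔ HasFiniteSocle p D := by
  classical
  have hp : p.Prime := Fact.out
  constructor
  · rintro ⟨r, hr⟩
    set Q : ℕ → Prop := fun n => ∃ s : Finset A, s.card = n ∧
      (∀ a ∈ s, a ∈ D ∧ a ≠ 1) ∧ (∀ a ∈ s, a ^ p = 1) ∧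
      ∀ c : A → ℤ, ∏ a ∈ s, a ^ c a = 1 → ∀ a ∈ s, a ^ c a = 1 with hQ
    have hQ0 : Q 0 := ⟨∅, rfl, by simp, by simp, by simp⟩
    have hQr : ∀ n, Q n → n ≤ r := by
      rintro n ⟨s, rfl, h1, -, h2⟩
      exact hr s h1 h2
    obtain ⟨s, hs, h1, h2, h3⟩ : Q (Nat.findGreatest Q r) :=
      Nat.findGreatest_spec (Nat.zero_le r) hQ0
    have hfin := finite_closure hA s.finite_toSet
    refine Set.Finite.subset (s := (fun d : D => (d : A)) ⁻¹'
      (Subgroup.closure (s : Set A) : Set A)) ?_ ?_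
    · exact Set.Finite.preimage Subtype.val_injective.injOn (Set.toFinite _)
    rintro ⟨x, hx⟩ hxp
    have hxp' : x ^ p = 1 := congrArg Subtype.val hxp
    show x ∈ Subgroup.closure (s : Set A)
    by_contra hxs
    have hxn : x ∉ s := fun h => hxs (Subgroup.subset_closure h)
    have hbig : Q (s.card + 1) := by
      refine ⟨insert x s, Finset.card_insert_of_notMem hxn, ?_, ?_, ?_⟩
      · intro a ha
        rcases Finset.mem_insert.1 ha with rfl | ha
        · exact ⟨hx, fun h => hxs (h ▸ one_mem _)⟩
        · exact h1 a ha
      · intro a ha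
        rcases Finset.mem_insert.1 ha with rfl | ha
        · exact hxp'
        · exact h2 a ha
      · intro c hc
        rw [Finset.prod_insert hxn] at hc
        have hmem : ∏ a ∈ s, a ^ c a ∈ Subgroup.closure (s : Set A) :=
          Subgroup.prod_mem _ fun a ha => zpow_mem (Subgroup.subset_closure ha) _
        have hxc : x ^ c x ∈ Subgroup.closure (s : Set A) := by
          rw [eq_inv_of_mul_eq_one_left hc]
          exact inv_mem hmem
        have hpc : (p : ℤ) ∣ c x := by
          by_contra hk
          refine hxs (zpow_mem_of_isCoprime
            (((Nat.prime_iff_prime_int.1 hp).coprime_iff_not_dvd).2 hk) ?_ hxc)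
          rw [zpow_natCast, hxp']
          exact one_mem _
        have hx1 : x ^ c x = 1 := by
          obtain ⟨l, hl⟩ := hpc
          rw [hl, zpow_mul, zpow_natCast, hxp', one_zpow]
        rw [hx1, one_mul] at hc
        intro a ha
        rcases Finset.mem_insert.1 ha with rfl | ha
        · exact hx1
        · exact h3 c hc a ha
    have hle := Nat.le_findGreatest (hQr _ hbig) hbig
    omega
  · intro h
    have : Finite {g : D | g ^ p = 1} := h
    refine ⟨Nat.card {g : D | g ^ p = 1}, fun s hs hind => ?_⟩
    have hpow : ∀ a : s, ∃ k : ℤ, (a : A) ^ k ≠ 1 ∧ ((a : A) ^ k) ^ p = 1 := by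
      rintro ⟨a, ha⟩
      obtain ⟨b, hb, hb1, hbp⟩ := exists_pow_eq_one_of_ne_bot hA
        (D := Subgroup.zpowers a) (by simpa using (hs a ha).2)
      obtain ⟨k, rfl⟩ := Subgroup.mem_zpowers_iff.1 hb
      exact ⟨k, hb1, hbp⟩
    choose k hk1 hkp using hpow
    rw [← Nat.card_eq_finsetCard s]
    refine Nat.card_le_card_of_injective
      (fun a => (⟨⟨(a : A) ^ k a, zpow_mem (hs a a.2).1 _⟩, Subtype.ext (hkp a)⟩ :
        {g : D | g ^ p = 1})) ?_
    rintro ⟨a, ha⟩ ⟨b, hb⟩ hab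
    have hab' : a ^ k ⟨a, ha⟩ = b ^ k ⟨b, hb⟩ :=
      congrArg (fun z : {g : D | g ^ p = 1} => ((z : D) : A)) hab
    by_contra hne
    have hne' : a ≠ b := fun h => hne (Subtype.ext h)
    refine hk1 ⟨a, ha⟩ ?_
    have := hind (fun x => if x = a then k ⟨a, ha⟩ else if x = b then - k ⟨b, hb⟩ else 0) ?_ a ha
    · simpa using this
    · rw [← Finset.prod_subset (s₁ := {a, b})]
      · rw [Finset.prod_pair hne']
        simp [hne'.symm, hab']
      · intro x hx
        rcases Finset.mem_insert.1 hx with rfl | hx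
        · exact ha
        · rw [Finset.mem_singleton.1 hx]; exact hb
      · intro x _ hx
        simp only [Finset.mem_insert, Finset.mem_singleton, not_or] at hx
        simp [hx.1, hx.2]

end Complements

/-! ### Power automorphisms as multiplications by `p`-adic integers -/

section PowerMaps

variable {p : ℕ} [Fact p.Prime] {A : Type*} [CommGroup A]

/-- The sequence `n` represents a `p`-adic integer, that is, `n (k + 1) ≡ n k` modulo `p ^ k`. -/
def IsCompatible (p : ℕ) (n : ℕ → ℤ) : Prop := ∀ k, (p : ℤ) ^ k ∣ n (k + 1) - n k

theorem IsCompatible.dvd_sub {n : ℕ → ℤ} (hn : IsCompatible p n) {j k : ℕ} (hjk : j ≤ k) :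
    (p : ℤ) ^ j ∣ n k - n j := by
  induction k, hjk using Nat.le_induction with
  | base => simp
  | succ k hjk ih =>
    have := dvd_add ((pow_dvd_pow (p : ℤ) hjk).trans (hn k)) ih
    rwa [sub_add_sub_cancel] at this

theorem zpow_eq_zpow_of_dvd_sub {a : A} {N : ℕ} (ha : a ^ N = 1) {k l : ℤ}
    (h : (N : ℤ) ∣ k - l) : a ^ k = a ^ l := by
  obtain ⟨m, hm⟩ := h
  rw [sub_eq_iff_eq_add.1 hm, zpow_add, zpow_mul, zpow_natCast, ha, one_zpow, one_mul]

theorem IsCompatible.zpow_eq {n : ℕ → ℤ} (hn : IsCompatible p n) {a : A} {j k : ℕ}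
    (hj : a ^ p ^ j = 1) (hk : a ^ p ^ k = 1) : a ^ n j = a ^ n k := by
  rcases le_total j k with h | h
  · exact (zpow_eq_zpow_of_dvd_sub hj (by simpa using hn.dvd_sub h)).symm
  · exact zpow_eq_zpow_of_dvd_sub hk (by simpa using hn.dvd_sub h)

theorem pow_eq_one_of_le {a : A} {j k : ℕ} (hjk : j ≤ k) (h : a ^ p ^ j = 1) : a ^ p ^ k = 1 := by
  obtain ⟨l, rfl⟩ := Nat.exists_eq_add_of_le hjk
  rw [pow_add, pow_mul, h, one_pow]

theorem IsCompatible.exists_hom (hA : IsPGroup p A) {n : ℕ → ℤ} (hn : IsCompatible p n) :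
    ∃ α : A →* A, ∀ (a : A) (k : ℕ), a ^ p ^ k = 1 → α a = a ^ n k := by
  choose e he using hA
  refine ⟨⟨⟨fun a => a ^ n (e a), one_zpow _⟩, fun a b => ?_⟩, fun a k hk =>
    hn.zpow_eq (he a) hk⟩
  have ha := pow_eq_one_of_le (le_max_left (e a) (e b)) (he a)
  have hb := pow_eq_one_of_le (le_max_right (e a) (e b)) (he b)
  have hab : (a * b) ^ p ^ max (e a) (e b) = 1 := by rw [mul_pow, ha, hb, one_mul]
  show (a * b) ^ n (e (a * b)) = a ^ n (e a) * b ^ n (e b)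
  rw [hn.zpow_eq (he _) hab, hn.zpow_eq (he a) ha, hn.zpow_eq (he b) hb, mul_zpow]

/-- Cyclic subgroups are finite, so an injective map of one into itself is onto. -/
theorem isPower_of_mem_zpowers (hA : IsPGroup p A) {γ : MulAut A}
    (h : ∀ a, γ a ∈ Subgroup.zpowers a) : IsPower γ := by
  have hp : p.Prime := Fact.out
  intro H
  refine le_antisymm ?_ fun a ha => ?_
  · rintro _ ⟨a, ha, rfl⟩
    exact (Subgroup.zpowers_le.2 ha) (h a)
  · have hfin : Finite (Subgroup.zpowers a) := by
      obtain ⟨k, hk⟩ := hA a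
      refine Set.Finite.to_subtype (finite_zpowers.2 ?_)
      exact isOfFinOrder_iff_pow_eq_one.2 ⟨_, pow_pos hp.pos k, hk⟩
    have hle : (Subgroup.zpowers a).map γ.toMonoidHom ≤ Subgroup.zpowers a := by
      rintro _ ⟨b, hb, rfl⟩
      exact (Subgroup.zpowers_le.2 hb) (h b)
    have heq := Subgroup.eq_of_le_of_card_ge hle
      (Subgroup.card_map_of_injective (f := γ.toMonoidHom) γ.injective).ge
    have : a ∈ (Subgroup.zpowers a).map γ.toMonoidHom := by rw [heq]; exact Subgroup.mem_zpowers a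
    obtain ⟨b, hb, hba⟩ := this
    exact ⟨b, (Subgroup.zpowers_le.2 ha) hb, hba⟩

theorem IsPower.mem_zpowers {γ : MulAut A} (h : IsPower γ) (a : A) : γ a ∈ Subgroup.zpowers a := by
  have hmem : γ a ∈ (Subgroup.zpowers a).map γ.toMonoidHom := ⟨a, Subgroup.mem_zpowers a, rfl⟩
  rwa [h (Subgroup.zpowers a)] at hmem

theorem IsCompatible.not_dvd {n : ℕ → ℤ} (hn : IsCompatible p n) (h1 : ¬ (p : ℤ) ∣ n 1) {k : ℕ}
    (hk : k ≠ 0) : ¬ (p : ℤ) ∣ n k := by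
  intro h
  have := hn.dvd_sub (Nat.one_le_iff_ne_zero.2 hk)
  rw [pow_one] at this
  exact h1 ((dvd_sub_right h).1 this)

theorem IsCompatible.isCoprime {n : ℕ → ℤ} (hn : IsCompatible p n) (h1 : ¬ (p : ℤ) ∣ n 1)
    (k : ℕ) : IsCoprime (n k) ((p : ℤ) ^ k) := by
  have hp : p.Prime := Fact.out
  rcases eq_or_ne k 0 with rfl | hk
  · simpa using isCoprime_one_right
  · exact (((Nat.prime_iff_prime_int.1 hp).coprime_iff_not_dvd).2 (hn.not_dvd h1 hk)).symm.pow_right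

theorem IsCompatible.exists_mulAut (hA : IsPGroup p A) {n : ℕ → ℤ} (hn : IsCompatible p n)
    (h1 : ¬ (p : ℤ) ∣ n 1) :
    ∃ α ∈ PAut A, ∀ (a : A) (k : ℕ), a ^ p ^ k = 1 → α a = a ^ n k := by
  obtain ⟨α, hα⟩ := hn.exists_hom hA
  have hbij : Function.Bijective α := by
    constructor
    · rw [injective_iff_map_eq_one]
      intro a ha
      obtain ⟨k, hk⟩ := hA a
      rw [hα a k hk] at ha
      exact Subgroup.mem_bot.1 (zpow_mem_of_isCoprime (H := ⊥) (hn.isCoprime h1 k)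
        (Subgroup.mem_bot.2 ha) (Subgroup.mem_bot.2 (by exact_mod_cast hk)))
    · intro a
      obtain ⟨k, hk⟩ := hA a
      obtain ⟨u, v, huv⟩ := hn.isCoprime h1 k
      refine ⟨a ^ u, ?_⟩
      rw [map_zpow, hα a k hk, ← zpow_mul, mul_comm, eq_sub_of_add_eq huv]
      conv_rhs => rw [← zpow_one a]
      exact zpow_eq_zpow_of_dvd_sub hk (by simp)
  refine ⟨MulEquiv.ofBijective α hbij, isPower_of_mem_zpowers hA fun a => ?_, hα⟩
  obtain ⟨k, hk⟩ := hA a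
  exact ⟨n k, (hα a k hk).symm⟩

theorem pow_dvd_of_zpow_mem (hA : IsPGroup p A) {X : Subgroup A} {c : A} {n : ℕ}
    (hc : c ^ p ^ n ∉ X) {k : ℤ} (hk : c ^ k ∈ X) : (p : ℤ) ^ (n + 1) ∣ k := by
  obtain ⟨l, hl⟩ := IsPGroup.iff_orderOf.1 (hA.to_quotient X) (c : A ⧸ X)
  have h1 : ((orderOf (c : A ⧸ X) : ℕ) : ℤ) ∣ k := by
    rw [orderOf_dvd_iff_zpow_eq_one, ← QuotientGroup.mk_zpow]
    exact (QuotientGroup.eq_one_iff _).2 hk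
  rw [hl, Nat.cast_pow] at h1
  refine (pow_dvd_pow (p : ℤ) ?_).trans h1
  by_contra hlt
  apply hc
  rw [← QuotientGroup.eq_one_iff, QuotientGroup.mk_pow]
  exact pow_eq_one_of_le (show l ≤ n by omega) (by rw [← hl]; exact pow_orderOf_eq_one _)

/-- Write `y = z * x ^ s'` with `⟨z⟩ ∩ ⟨x⟩ = 1`. Comparing `φ (x * z)`, a power of `x * z`, with `φ
x * φ z` forces the same exponent on `z` as on `x`. -/
theorem apply_eq_zpow_of_orderOf_dvd (hA : IsPGroup p A) {H : Subgroup A} {φ : A →* A}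
    (hφ : ∀ z ∈ H, φ z ∈ Subgroup.zpowers z) {x y : A} (hx : x ∈ H) (hy : y ∈ H) {n : ℤ}
    (hxn : φ x = x ^ n) (hxy : orderOf y ∣ orderOf x) : φ y = y ^ n := by
  classical
  have hp : p.Prime := Fact.out
  have hp0 : (p : ℤ) ≠ 0 := by exact_mod_cast hp.ne_zero
  obtain ⟨j, hj⟩ := IsPGroup.iff_orderOf.1 hA x
  obtain ⟨i, hi⟩ := IsPGroup.iff_orderOf.1 hA y
  have hyi : y ^ p ^ i = 1 := by rw [← hi]; exact pow_orderOf_eq_one y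
  have hyj : y ^ p ^ j = 1 := by rw [← hj]; exact orderOf_dvd_iff_pow_eq_one.1 hxy
  have hxj : x ^ p ^ j = 1 := by rw [← hj]; exact pow_orderOf_eq_one x
  have hij : p ^ i ∣ p ^ j := by rwa [hi, hj] at hxy
  have hex : ∃ t, y ^ p ^ t ∈ Subgroup.zpowers x := ⟨i, by rw [hyi]; exact one_mem _⟩
  -- `p ^ t` is the order of `y` modulo `⟨x⟩`. As the order of `y` divides that of `x`, the exponent
  -- `s` in `x ^ s = y ^ p ^ t` is divisible by `p ^ t`, and this gives `z`.
  set t := Nat.find hex with ht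
  have hti : t ≤ i := Nat.find_min' hex (by rw [hyi]; exact one_mem _)
  obtain ⟨s, hs⟩ := Subgroup.mem_zpowers_iff.1 (Nat.find_spec hex)
  rw [← ht] at hs
  have hdvd : (p : ℤ) ^ t ∣ s := by
    have h1 : x ^ (s * (p : ℤ) ^ (i - t)) = 1 := by
      rw [zpow_mul, hs, ← Nat.cast_pow, zpow_natCast, ← pow_mul, ← pow_add,
        Nat.add_sub_cancel' hti, hyi]
    have h2 : (p : ℤ) ^ i ∣ s * (p : ℤ) ^ (i - t) := by
      refine dvd_trans ?_ (orderOf_dvd_iff_zpow_eq_one.2 h1)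
      rw [hj]
      exact_mod_cast hij
    rw [← Nat.add_sub_cancel' hti, pow_add, Nat.add_sub_cancel_left] at h2
    exact (mul_dvd_mul_iff_right (pow_ne_zero _ hp0)).1 h2
  obtain ⟨s', rfl⟩ := hdvd
  set z := y * x ^ (-s') with hz
  have hyz : y = z * x ^ s' := by rw [hz, zpow_neg, inv_mul_cancel_right]
  have hzH : z ∈ H := mul_mem hy (zpow_mem hx _)
  have hzt : z ^ p ^ t = 1 := by
    rw [hz, mul_pow, ← hs, ← zpow_natCast (x ^ (-s')), ← zpow_mul, ← zpow_add]
    push_cast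
    rw [show (p : ℤ) ^ t * s' + -s' * (p : ℤ) ^ t = 0 by ring, zpow_zero]
  have hzj : z ^ p ^ j = 1 := by
    rw [hz, mul_pow, hyj, one_mul, ← zpow_natCast, ← zpow_mul, mul_comm, zpow_mul, zpow_natCast,
      hxj, one_zpow]
  have hzk : ∀ k : ℤ, z ^ k ∈ Subgroup.zpowers x → z ^ k = 1 := by
    intro k hk
    have hyk : y ^ k ∈ Subgroup.zpowers x := by
      rw [hyz, mul_zpow]
      exact mul_mem hk (zpow_mem (zpow_mem (Subgroup.mem_zpowers x) _) _)
    have hdk : (p : ℤ) ^ t ∣ k := by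
      rcases Nat.eq_zero_or_pos t with h0 | h0
      · rw [h0, pow_zero]; exact one_dvd _
      · have := pow_dvd_of_zpow_mem hA (Nat.find_min hex (show t - 1 < t by omega)) hyk
        rwa [Nat.sub_add_cancel h0] at this
    obtain ⟨l, rfl⟩ := hdk
    rw [zpow_mul, ← Nat.cast_pow, zpow_natCast, hzt, one_zpow]
  obtain ⟨m, hm⟩ := Subgroup.mem_zpowers_iff.1 (hφ z hzH)
  obtain ⟨l, hl⟩ := Subgroup.mem_zpowers_iff.1 (hφ (x * z) (mul_mem hx hzH))
  have hrel : x ^ (l - n) = z ^ (m - l) := by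
    rw [map_mul, hxn, ← hm, mul_zpow] at hl
    rw [zpow_sub, zpow_sub, mul_inv_eq_iff_eq_mul, mul_right_comm, eq_mul_inv_iff_mul_eq, hl,
      mul_comm]
  have hz1 : z ^ (m - l) = 1 := hzk _ (hrel ▸ zpow_mem (Subgroup.mem_zpowers x) _)
  have hz2 : z ^ m = z ^ n := by
    have hzl : z ^ m = z ^ l := by
      rwa [zpow_sub, mul_inv_eq_one] at hz1
    rw [hzl]
    refine zpow_eq_zpow_of_dvd_sub hzj ?_
    rw [← hj]
    exact orderOf_dvd_iff_zpow_eq_one.2 (hrel.trans hz1)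
  clear_value z
  rw [hyz, map_mul, map_zpow, ← hm, hxn, hz2, mul_zpow, ← zpow_mul, ← zpow_mul, mul_comm n]

theorem exists_orderOf_eq_of_pow_ne_one (hA : IsPGroup p A) {H : Subgroup A} {k : ℕ}
    (h : ∃ x ∈ H, x ^ p ^ k ≠ 1) : ∃ x ∈ H, orderOf x = p ^ (k + 1) := by
  have hp : p.Prime := Fact.out
  obtain ⟨x, hx, hxk⟩ := h
  obtain ⟨j, hj⟩ := IsPGroup.iff_orderOf.1 hA x
  have hkj : k + 1 ≤ j := by
    by_contra hlt
    exact hxk (pow_eq_one_of_le (show j ≤ k by omega) (by rw [← hj]; exact pow_orderOf_eq_one x))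
  refine ⟨x ^ p ^ (j - (k + 1)), pow_mem hx _, ?_⟩
  rw [orderOf_pow_of_dvd (pow_ne_zero _ hp.ne_zero) (by rw [hj]; exact pow_dvd_pow p (by omega)),
    hj, Nat.pow_div (by omega) hp.pos]
  congr 1
  omega

/-- A homomorphism mapping every cyclic subgroup of `H` into itself is a `p`-adic multiplication
on `H`. -/
theorem exists_isCompatible (hA : IsPGroup p A) {H : Subgroup A} {φ : A →* A}
    (hφ : ∀ z ∈ H, φ z ∈ Subgroup.zpowers z) :
    ∃ n, IsCompatible p n ∧ ∀ x ∈ H, ∀ k, x ^ p ^ k = 1 → φ x = x ^ n k := by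
  classical
  by_cases hb : ∃ j, ∀ x ∈ H, x ^ p ^ j = 1
  · obtain ⟨x, hx, hmax⟩ : ∃ x ∈ H, ∀ y ∈ H, orderOf y ∣ orderOf x := by
      have hspec := Nat.find_spec hb
      rcases Nat.eq_zero_or_pos (Nat.find hb) with h0 | h0
      · rw [h0] at hspec
        refine ⟨1, H.one_mem, fun y hy => ?_⟩
        have := hspec y hy
        rw [pow_zero, pow_one] at this
        rw [this]
      · have := Nat.find_min hb (show Nat.find hb - 1 < Nat.find hb by omega)
        push Not at this
        obtain ⟨x, hx, hxo⟩ := exists_orderOf_eq_of_pow_ne_one hA this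
        rw [Nat.sub_add_cancel h0] at hxo
        exact ⟨x, hx, fun y hy => by rw [hxo]; exact orderOf_dvd_of_pow_eq_one (hspec y hy)⟩
    -- For bounded `H` the exponent at an element of maximal order serves for all of `H`, so a
    -- constant sequence suffices.
    obtain ⟨m, hm⟩ := Subgroup.mem_zpowers_iff.1 (hφ x hx)
    exact ⟨fun _ => m, fun k => by simp, fun y hy k _ =>
      apply_eq_zpow_of_orderOf_dvd hA hφ hx hy hm.symm (hmax y hy)⟩
  · push Not at hb
    have hex : ∀ k, ∃ x ∈ H, orderOf x = p ^ k := by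
      intro k
      cases k with
      | zero => exact ⟨1, H.one_mem, by simp⟩
      | succ k => exact exists_orderOf_eq_of_pow_ne_one hA (hb k)
    choose x hx hxo using hex
    have hm : ∀ k, ∃ m : ℤ, x k ^ m = φ (x k) := fun k =>
      Subgroup.mem_zpowers_iff.1 (hφ _ (hx k))
    choose m hm using hm
    have key : ∀ y ∈ H, ∀ k, y ^ p ^ k = 1 → φ y = y ^ m k := fun y hy k hk =>
      apply_eq_zpow_of_orderOf_dvd hA hφ (hx k) hy (hm k).symm
        (by rw [hxo]; exact orderOf_dvd_of_pow_eq_one hk)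
    refine ⟨m, fun k => ?_, key⟩
    have hxk : x k ^ p ^ k = 1 := by rw [← hxo]; exact pow_orderOf_eq_one _
    have h1 := key (x k) (hx k) (k + 1) (pow_eq_one_of_le (Nat.le_succ k) hxk)
    rw [← hm k] at h1
    rw [← Nat.cast_pow, ← hxo k, orderOf_dvd_iff_zpow_eq_one, zpow_sub, h1, mul_inv_cancel]

theorem exists_isCompatible_of_mem_PAut (hA : IsPGroup p A) {γ : MulAut A} (hγ : γ ∈ PAut A) :
    ∃ n, IsCompatible p n ∧ ∀ (x : A) (k : ℕ), x ^ p ^ k = 1 → γ x = x ^ n k := by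
  obtain ⟨n, hn, h⟩ := exists_isCompatible (φ := γ.toMonoidHom) (H := ⊤) hA
    fun z _ => IsPower.mem_zpowers hγ z
  exact ⟨n, hn, fun x k hk => h x trivial k hk⟩

theorem apply_comm_of_mem_PAut (hA : IsPGroup p A) {γ : MulAut A} (hγ : γ ∈ PAut A)
    (f : MulAut A) (a : A) : γ (f a) = f (γ a) := by
  obtain ⟨n, -, h⟩ := exists_isCompatible_of_mem_PAut hA hγ
  obtain ⟨k, hk⟩ := hA a
  rw [h a k hk, h (f a) k (by rw [← map_pow, hk, map_one]), map_zpow]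

theorem mul_comm_of_mem_PAut (hA : IsPGroup p A) {γ : MulAut A} (hγ : γ ∈ PAut A)
    (f : MulAut A) : γ * f = f * γ :=
  MulEquiv.ext fun a => apply_comm_of_mem_PAut hA hγ f a

theorem normal_PAut (hA : IsPGroup p A) : (PAut A).Normal :=
  ⟨fun γ hγ f => by rwa [← mul_comm_of_mem_PAut hA hγ f, mul_inv_cancel_right]⟩

/-- A power automorphism that is trivial on an unbounded subgroup is trivial. -/
theorem eq_one_of_mem_PAut (hA : IsPGroup p A) {γ : MulAut A} (hγ : γ ∈ PAut A) {H : Subgroup A}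
    (hH : ∀ k, ∃ x ∈ H, x ^ p ^ k ≠ 1) (hfix : ∀ x ∈ H, γ x = x) : γ = 1 := by
  obtain ⟨n, -, h⟩ := exists_isCompatible_of_mem_PAut hA hγ
  ext a
  obtain ⟨k, hk⟩ := hA a
  have hk' := pow_eq_one_of_le (Nat.le_succ k) hk
  obtain ⟨x, hx, hxo⟩ := exists_orderOf_eq_of_pow_ne_one hA (hH k)
  have hx1 : x ^ (n (k + 1) - 1) = 1 := by
    rw [zpow_sub, ← h x (k + 1) (by rw [← hxo]; exact pow_orderOf_eq_one x), hfix x hx, zpow_one,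
      mul_inv_cancel]
  rw [h a (k + 1) hk', MulAut.one_apply]
  conv_rhs => rw [← zpow_one a]
  refine zpow_eq_zpow_of_dvd_sub hk' ?_
  rw [← hxo]
  exact orderOf_dvd_iff_zpow_eq_one.2 hx1

end PowerMaps

/-! ### Structure of inertial endomorphisms -/

section InertialEndomorphisms

variable {p : ℕ} [Fact p.Prime] {A : Type*} [CommGroup A]

/-- The endomorphism `φ` is inertial: modulo every subgroup `H` the image of `H` is finite. -/
def IsInertEnd (φ : A →* A) : Prop :=
  ∀ H : Subgroup A, ((fun a => (φ a : A ⧸ H)) '' (H : Set A)).Finite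

/-- The index of `H` in `⟨H, γ(H)⟩` is the order of the image of `γ(H)` in `A/H`. The right side
makes sense for endomorphisms such as `γ - 1`. -/
theorem isInertial_iff {γ : MulAut A} : IsInertial γ ↔ IsInertEnd γ.toMonoidHom := by
  refine forall_congr' fun H => ?_
  have h1 : H.relIndex (H ⊔ H.map γ.toMonoidHom) =
      Nat.card ((H.map γ.toMonoidHom).map (QuotientGroup.mk' H)) := by
    rw [sup_comm, Subgroup.relIndex_sup_right, ← Subgroup.relIndex_ker, QuotientGroup.ker_mk']
  have h2 : (((H.map γ.toMonoidHom).map (QuotientGroup.mk' H) : Subgroup (A ⧸ H)) : Set (A ⧸ H)) =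
      (fun a => (γ.toMonoidHom a : A ⧸ H)) '' (H : Set A) := by
    rw [Subgroup.coe_map, Subgroup.coe_map, ← Set.image_comp]
    rfl
  constructor
  · rintro ⟨h⟩
    rw [h1] at h
    rw [← h2]
    exact Nat.finite_of_card_ne_zero h
  · intro h
    rw [← h2] at h
    refine ⟨?_⟩
    rw [h1]
    have : Finite ((H.map γ.toMonoidHom).map (QuotientGroup.mk' H)) := h
    exact Nat.card_pos.ne'

theorem IsInertEnd.exists_pow_mem {φ : A →* A} (hφ : IsInertEnd φ) (H : Subgroup A) :
    ∃ M ≠ 0, ∀ a ∈ H, φ a ^ M ∈ H := by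
  have h2 : (((H.map φ).map (QuotientGroup.mk' H) : Subgroup (A ⧸ H)) : Set (A ⧸ H)) =
      (fun a => (φ a : A ⧸ H)) '' (H : Set A) := by
    rw [Subgroup.coe_map, Subgroup.coe_map, ← Set.image_comp]
    rfl
  have hfin : Finite ((H.map φ).map (QuotientGroup.mk' H)) := by
    have := hφ H
    rw [← h2] at this
    exact this
  refine ⟨Nat.card ((H.map φ).map (QuotientGroup.mk' H)), Nat.card_pos.ne', fun a ha => ?_⟩
  have hmem : (φ a : A ⧸ H) ∈ (H.map φ).map (QuotientGroup.mk' H) := ⟨φ a, ⟨a, ha, rfl⟩, rfl⟩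
  have := congrArg Subtype.val (pow_card_eq_one' (x := (⟨_, hmem⟩ :
    (H.map φ).map (QuotientGroup.mk' H))))
  rw [← QuotientGroup.eq_one_iff, QuotientGroup.mk_pow]
  exact this

/-- The obstruction in `A/H` is killed by a fixed `M`, and every element of `H` is an `M`-th power
of another one. -/
theorem IsInertEnd.apply_mem_of_isDivisible {φ : A →* A} (hφ : IsInertEnd φ) {H : Subgroup A}
    (hH : IsDivisible H) {x : A} (hx : x ∈ H) : φ x ∈ H := by
  obtain ⟨M, hM, h⟩ := hφ.exists_pow_mem H
  obtain ⟨y, hy, rfl⟩ := hH M hM x hx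
  rw [map_pow]
  exact h y hy

theorem IsInertEnd.mem_zpowers_of_isDivisible (hA : IsPGroup p A) {φ : A →* A}
    (hφ : IsInertEnd φ) {D : Subgroup A} (hD : IsDivisible D) {x : A} (hx : x ∈ D) :
    φ x ∈ Subgroup.zpowers x := by
  have hp : p.Prime := Fact.out
  have hp0 : (p : ℤ) ≠ 0 := by exact_mod_cast hp.ne_zero
  have hroot : ∀ d : D, ∃ e : D, e ^ p = d := fun d => by
    obtain ⟨e, he, hed⟩ := hD p hp.ne_zero d d.2
    exact ⟨⟨e, he⟩, Subtype.ext hed⟩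
  choose r hr using hroot
  -- Iterated `p`-th roots of `x` generate a divisible, locally cyclic subgroup, which `φ`
  -- preserves. So `φ x` is a power of some `y i`, and comparing orders shows that it is a power of
  -- `x`.
  set y : ℕ → A := fun i => (r^[i] ⟨x, hx⟩ : D) with hy
  have hy0 : y 0 = x := rfl
  have hys : ∀ i, y (i + 1) ^ p = y i := fun i => by
    have := congrArg Subtype.val (hr (r^[i] ⟨x, hx⟩))
    simp only [hy, Function.iterate_succ_apply']
    exact this
  clear_value y
  have hmono : Monotone fun i => Subgroup.zpowers (y i) := by
    refine monotone_nat_of_le_succ fun i => ?_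
    rw [Subgroup.zpowers_le, ← hys i]
    exact pow_mem (Subgroup.mem_zpowers _) _
  have hyp : ∀ i, y i ^ p ^ i = x := by
    intro i
    induction i with
    | zero => simp [hy0]
    | succ i ih => rw [pow_succ', pow_mul, hys, ih]
  have hdiv : IsDivisible (⨆ i, Subgroup.zpowers (y i)) := by
    refine isDivisible_of_prime hA fun z hz => ?_
    obtain ⟨i, hi⟩ := (Subgroup.mem_iSup_of_directed hmono.directed_le).1 hz
    obtain ⟨k, rfl⟩ := Subgroup.mem_zpowers_iff.1 hi
    refine ⟨y (i + 1) ^ k, Subgroup.mem_iSup_of_mem (i + 1)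
      (zpow_mem (Subgroup.mem_zpowers _) _), ?_⟩
    rw [← hys i, ← zpow_natCast, ← zpow_natCast, ← zpow_mul, ← zpow_mul, mul_comm]
  have hmem := hφ.apply_mem_of_isDivisible hdiv
    (Subgroup.mem_iSup_of_mem (S := fun i => Subgroup.zpowers (y i)) 0
      (by rw [hy0]; exact Subgroup.mem_zpowers x))
  obtain ⟨i, hi⟩ := (Subgroup.mem_iSup_of_directed hmono.directed_le).1 hmem
  obtain ⟨k, hk⟩ := Subgroup.mem_zpowers_iff.1 hi
  rcases eq_or_ne x 1 with rfl | hx1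
  · rw [map_one]; exact one_mem _
  obtain ⟨j, hj⟩ := IsPGroup.iff_orderOf.1 hA x
  have hyo : orderOf (y i) = p ^ (i + j) := by
    obtain ⟨l, hl⟩ := IsPGroup.iff_orderOf.1 hA (y i)
    have hil : i ≤ l := by
      by_contra hlt
      apply hx1
      rw [← hyp i]
      exact pow_eq_one_of_le (show l ≤ i by omega) (by rw [← hl]; exact pow_orderOf_eq_one _)
    have hxo : orderOf x = p ^ (l - i) := by
      rw [← hyp i, orderOf_pow_of_dvd (pow_ne_zero _ hp.ne_zero)
        (by rw [hl]; exact pow_dvd_pow p hil), hl, Nat.pow_div hil hp.pos]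
    have := Nat.pow_right_injective hp.two_le (hj.symm.trans hxo)
    rw [hl]
    congr 1
    omega
  have hpk : (p : ℤ) ^ i ∣ k := by
    have h1 : y i ^ (k * (p : ℤ) ^ j) = 1 := by
      rw [zpow_mul, hk, ← Nat.cast_pow, zpow_natCast, ← map_pow, ← hj, pow_orderOf_eq_one, map_one]
    have h2 := orderOf_dvd_iff_zpow_eq_one.2 h1
    rw [hyo, Nat.cast_pow, pow_add] at h2
    exact (mul_dvd_mul_iff_right (pow_ne_zero _ hp0)).1 h2
  obtain ⟨l, rfl⟩ := hpk
  rw [← hk, zpow_mul, ← Nat.cast_pow, zpow_natCast, hyp]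
  exact zpow_mem (Subgroup.mem_zpowers x) _

/-- If no finite `F` works, choose inductively `x n` with `φ (x n) ∉ ⟨x n⟩` and `⟨x n, φ (x n)⟩`
disjoint from the finite subgroup `K n` containing all earlier `x i` and `φ (x i)`. Modulo the span
of all `x n` the images `φ (x n)` are pairwise distinct, contradicting inertiality. -/
theorem IsInertEnd.exists_finite_subgroup (hA : IsPGroup p A) {φ : A →* A} (hφ : IsInertEnd φ) :
    ∃ F : Subgroup A, Finite F ∧
      ∀ x, Disjoint (Subgroup.closure {x, φ x}) F → φ x ∈ Subgroup.zpowers x := by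
  by_contra hcon
  push Not at hcon
  choose g hg hg' using fun F : {F : Subgroup A // Finite F} => hcon F.1 F.2
  set nxt : {F : Subgroup A // Finite F} → {F : Subgroup A // Finite F} := fun F =>
    ⟨Subgroup.closure ((F.1 : Set A) ∪ {g F, φ (g F)}), by
      have := F.2
      exact finite_closure hA ((Set.toFinite (F.1 : Set A)).union (Set.toFinite _))⟩ with hnxt
  set K : ℕ → {F : Subgroup A // Finite F} := fun n => nxt^[n] ⟨⊥, inferInstance⟩ with hK
  have hKs : ∀ n, K (n + 1) = nxt (K n) := fun n => Function.iterate_succ_apply' _ _ _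
  clear_value K
  set x : ℕ → A := fun n => g (K n) with hx
  have hKle : ∀ n, (K n).1 ≤ (K (n + 1)).1 := fun n => by
    rw [hKs]
    exact fun a ha => Subgroup.subset_closure (Or.inl ha)
  have hKm : Monotone fun n => (K n).1 := monotone_nat_of_le_succ hKle
  have hxK : ∀ n, x n ∈ (K (n + 1)).1 := fun n => by
    rw [hKs]
    exact Subgroup.subset_closure (Or.inr (Or.inl rfl))
  have hφK : ∀ n, φ (x n) ∈ (K (n + 1)).1 := fun n => by
    rw [hKs]
    exact Subgroup.subset_closure (Or.inr (Or.inr rfl))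
  have hdis : ∀ n (k l : ℤ), φ (x n) ^ k * x n ^ l ∈ (K n).1 → φ (x n) ^ k * x n ^ l = 1 := by
    intro n k l h
    refine Subgroup.disjoint_def.1 (hg (K n)) (mul_mem (zpow_mem ?_ _) (zpow_mem ?_ _)) h
    · exact Subgroup.subset_closure (Or.inr rfl)
    · exact Subgroup.subset_closure (Or.inl rfl)
  set H : ℕ → Subgroup A := fun n => Subgroup.closure (x '' Set.Iio n) with hH
  have hHm : Monotone H := fun m n hmn =>
    Subgroup.closure_mono (Set.image_mono (Set.Iio_subset_Iio hmn))
  have hHK : ∀ n, H n ≤ (K n).1 := fun n => by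
    rw [hH, Subgroup.closure_le]
    rintro _ ⟨i, hi, rfl⟩
    exact hKm (show i + 1 ≤ n from hi) (hxK i)
  have hHs : ∀ n, ∀ y ∈ H (n + 1), ∃ h ∈ H n, ∃ k : ℤ, y = h * x n ^ k := by
    intro n y hy
    have hI : Set.Iio (n + 1) = Set.Iio n ∪ {n} := by
      ext i
      simp only [Set.mem_Iio, Set.union_singleton, Set.mem_insert_iff]
      omega
    simp only [hH, hI, Set.image_union, Subgroup.closure_union, Set.image_singleton,
      ← Subgroup.zpowers_eq_closure] at hy
    obtain ⟨h, hh, w, hw, rfl⟩ := Subgroup.mem_sup.1 hy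
    obtain ⟨k, rfl⟩ := Subgroup.mem_zpowers_iff.1 hw
    exact ⟨h, hh, k, rfl⟩
  -- Later generators contribute nothing to elements of `K n`, so a relation modulo the whole span
  -- already involves only finitely many known generators.
  have hHn : ∀ n m, n ≤ m → ∀ y ∈ H m, y ∈ (K n).1 → y ∈ H n := by
    intro n m hnm
    induction m, hnm using Nat.le_induction with
    | base => exact fun y hy _ => hy
    | succ m hnm ih =>
      intro y hy hyK
      obtain ⟨h, hh, k, rfl⟩ := hHs m y hy
      have h1 : x m ^ k ∈ (K m).1 := by
        have := mul_mem (inv_mem (hHK m hh)) (hKm hnm hyK)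
        rwa [inv_mul_cancel_left] at this
      have h2 : x m ^ k = 1 := by
        simpa using hdis m 0 k (by simpa using h1)
      rw [h2, mul_one] at hyK ⊢
      exact ih h hh hyK
  have hinj : Function.Injective fun i => (φ (x i) : A ⧸ (⨆ n, H n)) := by
    have hlt : ∀ i j, i < j → (φ (x i) : A ⧸ (⨆ n, H n)) ≠ φ (x j) := by
      intro i j hij heq
      rw [QuotientGroup.eq] at heq
      obtain ⟨m, hm⟩ := (Subgroup.mem_iSup_of_directed hHm.directed_le).1 heq
      have hi : φ (x i) ∈ (K j).1 := hKm (show i + 1 ≤ j from hij) (hφK i)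
      have h1 := hHn (j + 1) (max m (j + 1)) (le_max_right _ _) _ (hHm (le_max_left _ _) hm)
        (mul_mem (inv_mem (hKle j hi)) (hφK j))
      obtain ⟨h, hh, k, hk⟩ := hHs j _ h1
      have h2 : φ (x j) ^ (1 : ℤ) * x j ^ (-k) = φ (x i) * h := by
        rw [inv_mul_eq_iff_eq_mul] at hk
        rw [zpow_one, hk, zpow_neg, ← mul_assoc, mul_inv_cancel_right]
      have h3 := hdis j 1 (-k) (by rw [h2]; exact mul_mem hi (hHK j hh))
      rw [zpow_one, zpow_neg, mul_inv_eq_one] at h3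
      exact hg' (K j) (by
        show φ (x j) ∈ Subgroup.zpowers (x j)
        rw [h3]; exact zpow_mem (Subgroup.mem_zpowers _) _)
    intro i j hij
    rcases lt_trichotomy i j with h | h | h
    · exact absurd hij (hlt i j h)
    · exact h
    · exact absurd hij.symm (hlt j i h)
  refine Set.infinite_range_of_injective hinj ((hφ (⨆ n, H n)).subset ?_)
  rintro _ ⟨i, rfl⟩
  exact ⟨x i, Subgroup.mem_iSup_of_mem (i + 1)
    (Subgroup.subset_closure ⟨i, Nat.lt_succ_self i, rfl⟩), rfl⟩

/-- An inertial endomorphism of a `p`-group is a power map on a subgroup with factor group of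
finite rank. -/
theorem IsInertEnd.exists_subgroup (hA : IsPGroup p A) {φ : A →* A} (hφ : IsInertEnd φ) :
    ∃ H : Subgroup A, HasFiniteSocle p (A ⧸ H) ∧ ∀ x ∈ H, φ x ∈ Subgroup.zpowers x := by
  obtain ⟨F, hF, h⟩ := hφ.exists_finite_subgroup hA
  obtain ⟨K, hKF, hK⟩ := exists_disjoint_hasFiniteSocle (p := p) F
  -- The kernel consists of the `x` with both `x` and `φ x` in `K`, so that `⟨x, φ x⟩` avoids `F`.
  set f : A →* (A ⧸ K) × (A ⧸ K) :=
    (QuotientGroup.mk' K).prod ((QuotientGroup.mk' K).comp φ) with hf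
  refine ⟨f.ker, (hK.prod hK).of_injective (QuotientGroup.kerLift_injective f), fun x hx => ?_⟩
  have hx1 : x ∈ K := (QuotientGroup.eq_one_iff x).1 (congrArg Prod.fst hx)
  have hx2 : φ x ∈ K := (QuotientGroup.eq_one_iff (φ x)).1 (congrArg Prod.snd hx)
  refine h x (hKF.mono_left ?_)
  rw [Subgroup.closure_le]
  rintro y (rfl | rfl)
  · exact hx1
  · exact hx2

/-- Since `φ` vanishes on `D`, its values on `A` are its values on the complement `H`, so
inertiality at the single subgroup `H` bounds all of `A`. -/
theorem IsInertEnd.exists_isCompl_pow_mem (hA : IsPGroup p A) {φ : A →* A} (hφ : IsInertEnd φ)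
    {D W : Subgroup A} (hD : IsDivisible D) (hφD : ∀ d ∈ D, φ d = 1) (hW : Disjoint W D) :
    ∃ H, W ≤ H ∧ IsCompl D H ∧ ∃ M ≠ 0, ∀ a, φ a ^ M ∈ H := by
  obtain ⟨H, hWH, hH⟩ := exists_isCompl_of_isDivisible hA hD hW
  obtain ⟨M, hM, h⟩ := hφ.exists_pow_mem H
  refine ⟨H, hWH, hH, M, hM, fun a => ?_⟩
  have ha : a ∈ D ⊔ H := by rw [hH.sup_eq_top]; trivial
  obtain ⟨d, hd, b, hb, rfl⟩ := Subgroup.mem_sup.1 ha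
  rw [map_mul, hφD d hd, one_mul]
  exact h b hb

/-- An inertial endomorphism that vanishes on a nontrivial divisible subgroup of a `p`-group is
bounded. -/
theorem IsInertEnd.exists_pow_eq_one (hA : IsPGroup p A) {φ : A →* A} (hφ : IsInertEnd φ)
    {D : Subgroup A} (hD : IsDivisible D) (hne : D ≠ ⊥) (hφD : ∀ d ∈ D, φ d = 1) :
    ∃ N ≠ 0, ∀ a, φ a ^ N = 1 := by
  have hp : p.Prime := Fact.out
  by_contra hcon
  push Not at hcon
  -- If `φ` were unbounded, one could build an ascending chain of finite subgroups disjoint from `D`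
  -- that contain elements `φ a * e` with `e ∈ D` of ever larger order. A complement of `D`
  -- containing the union then contradicts the uniform bound `M` for it.
  have hstep : ∀ (n : ℕ) (W : {W : Subgroup A // Finite W ∧ Disjoint W D}),
      ∃ W' : {W : Subgroup A // Finite W ∧ Disjoint W D}, W.1 ≤ W'.1 ∧
        ∃ a, ∃ e ∈ D, orderOf e = p ^ (n + 1) ∧ φ a * e ∈ W'.1 := by
    rintro n ⟨W, hWf, hWD⟩
    obtain ⟨H, hWH, hH, M, hM, hMH⟩ := hφ.exists_isCompl_pow_mem hA hD hφD hWD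
    obtain ⟨a, ha⟩ := hcon (M * p ^ n * Nat.card W)
      (mul_ne_zero (mul_ne_zero hM (pow_ne_zero _ hp.ne_zero)) Nat.card_pos.ne')
    set c := φ (a ^ M) with hc
    have hcH : c ∈ H := by rw [hc, map_pow]; exact hMH a
    -- So `c ^ k ∈ W` forces `p ^ (n + 1) ∣ k`, hence `e ^ k = 1`; this keeps the enlarged subgroup
    -- disjoint from `D`.
    have hcW : c ^ p ^ n ∉ W := by
      intro hmem
      apply ha
      rw [pow_mul, pow_mul, ← map_pow]
      exact congrArg Subtype.val (pow_card_eq_one' (x := (⟨_, hmem⟩ : W)))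
    obtain ⟨e, he, heo⟩ := exists_orderOf_eq_of_isDivisible hA hD hne (n + 1)
    refine ⟨⟨Subgroup.closure ((W : Set A) ∪ {c * e}), finite_closure hA
      ((Set.toFinite (W : Set A)).union (Set.toFinite _)), ?_⟩, fun w hw =>
        Subgroup.subset_closure (Or.inl hw), a ^ M, e, he, heo,
        Subgroup.subset_closure (Or.inr rfl)⟩
    rw [Subgroup.closure_union, Subgroup.closure_eq, ← Subgroup.zpowers_eq_closure,
      Subgroup.disjoint_def]
    intro y hy hyD
    obtain ⟨w, hw, z, hz, rfl⟩ := Subgroup.mem_sup.1 hy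
    obtain ⟨k, rfl⟩ := Subgroup.mem_zpowers_iff.1 hz
    rw [mul_zpow, ← mul_assoc] at hyD ⊢
    have h1 : w * c ^ k ∈ D := by
      have := mul_mem hyD (inv_mem (zpow_mem he k))
      rwa [mul_inv_cancel_right] at this
    have h2 : w * c ^ k = 1 := Subgroup.disjoint_def.1 hH.disjoint h1
      (mul_mem (hWH hw) (zpow_mem hcH k))
    have h3 : c ^ k ∈ W := by
      rw [eq_inv_of_mul_eq_one_right h2]
      exact inv_mem hw
    have h4 : e ^ k = 1 := by
      rw [← orderOf_dvd_iff_zpow_eq_one, heo, Nat.cast_pow]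
      exact pow_dvd_of_zpow_mem hA hcW h3
    rw [h2, h4, one_mul]
  choose nxt hle hnxt using hstep
  set W : ℕ → {W : Subgroup A // Finite W ∧ Disjoint W D} := fun n =>
    Nat.rec ⟨⊥, inferInstance, disjoint_bot_left⟩ (fun n W => nxt n W) n with hW
  have hWm : Monotone fun n => (W n).1 := monotone_nat_of_le_succ fun n => hle n (W n)
  have hWD : Disjoint (⨆ n, (W n).1) D := by
    rw [Subgroup.disjoint_def]
    intro y hy hyD
    obtain ⟨n, hn⟩ := (Subgroup.mem_iSup_of_directed hWm.directed_le).1 hy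
    exact Subgroup.disjoint_def.1 (W n).2.2 hn hyD
  obtain ⟨H, hWH, hH, M, hM, hMH⟩ := hφ.exists_isCompl_pow_mem hA hD hφD hWD
  -- Stage `M` is the one to look at: there `e` has order `p ^ (M + 1) > M`, whereas `e ^ M ∈ D ∩ H
  -- = 1`.
  obtain ⟨a, e, he, heo, hae⟩ := hnxt M (W M)
  have h1 : φ a * e ∈ H := hWH (Subgroup.mem_iSup_of_mem (S := fun n => (W n).1) (M + 1) hae)
  have h2 : e ^ M ∈ H := by
    have := mul_mem (inv_mem (hMH a)) (pow_mem h1 M)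
    rwa [mul_pow, inv_mul_cancel_left] at this
  have h3 : e ^ M = 1 := Subgroup.disjoint_def.1 hH.disjoint (pow_mem he M) h2
  have h4 := Nat.le_of_dvd (Nat.pos_of_ne_zero hM) (orderOf_dvd_of_pow_eq_one h3)
  rw [heo] at h4
  have h5 : M + 1 < p ^ (M + 1) := Nat.lt_pow_self hp.one_lt
  omega

end InertialEndomorphisms

/-! ### The non-critical case -/

section NonCritical

variable {p : ℕ} [Fact p.Prime] {A C : Type*} [CommGroup A] [CommGroup C]

theorem mem_FAut_iff {γ : MulAut A} :
    γ ∈ FAut A ↔ Finite (γ.toMonoidHom / MonoidHom.id A).range := by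
  have hker : ∀ a, a ∈ (γ.toMonoidHom / MonoidHom.id A).ker ↔ γ a = a := fun a => by
    rw [MonoidHom.mem_ker, MonoidHom.div_apply, div_eq_one]
    rfl
  have hfin : (γ.toMonoidHom / MonoidHom.id A).ker.FiniteIndex ↔
      Finite (γ.toMonoidHom / MonoidHom.id A).range := by
    rw [Subgroup.finiteIndex_iff, Subgroup.index_ker]
    exact ⟨Nat.finite_of_card_ne_zero, fun h => Nat.card_pos.ne'⟩
  rw [← hfin]
  constructor
  · rintro ⟨H, hH, hfix⟩
    exact Subgroup.finiteIndex_of_le fun a ha => (hker a).2 (hfix a ha)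
  · intro h
    exact ⟨_, h, fun a ha => (hker a).1 ha⟩

theorem isInertEnd_div_id_iff {φ : A →* A} :
    IsInertEnd (φ / MonoidHom.id A) ↔ IsInertEnd φ := by
  refine forall_congr' fun H => ?_
  have : (fun a => ((φ / MonoidHom.id A) a : A ⧸ H)) '' (H : Set A) =
      (fun a => (φ a : A ⧸ H)) '' (H : Set A) := by
    refine Set.image_congr fun a ha => ?_
    rw [MonoidHom.div_apply, QuotientGroup.mk_div, MonoidHom.id_apply,
      (QuotientGroup.eq_one_iff a).2 ha, div_one]
  rw [this]

theorem isInertial_of_mem_FAut {γ : MulAut A} (hγ : γ ∈ FAut A) : IsInertial γ := by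
  rw [isInertial_iff, ← isInertEnd_div_id_iff]
  have hfin := mem_FAut_iff.1 hγ
  intro H
  refine ((Set.toFinite ((γ.toMonoidHom / MonoidHom.id A).range : Set A)).image
    (QuotientGroup.mk : A → A ⧸ H)).subset ?_
  rintro _ ⟨a, -, rfl⟩
  exact ⟨_, ⟨a, rfl⟩, rfl⟩

theorem isInertial_mul_of_mem_PAut {G : Type*} [Group G] {α γ : MulAut G} (hα : α ∈ PAut G)
    (hγ : IsInertial γ) :
    IsInertial (α * γ) := by
  intro H
  have h : (α * γ).toMonoidHom = α.toMonoidHom.comp γ.toMonoidHom := rfl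
  rw [h, ← Subgroup.map_map, hα]
  exact hγ H

theorem isInertial_of_mem_PAut {α : MulAut A} (hα : α ∈ PAut A) : IsInertial α := by
  have := isInertial_mul_of_mem_PAut hα (isInertial_of_mem_FAut (one_mem (FAut A)))
  rwa [mul_one] at this

theorem PAut_le_IAut : PAut A ≤ IAut A := fun _ hα =>
  Subgroup.subset_closure (isInertial_of_mem_PAut hα)

theorem FAut_le_IAut : FAut A ≤ IAut A := fun _ hα =>
  Subgroup.subset_closure (isInertial_of_mem_FAut hα)

/-- Injectivity of `γ` on an element of order `p` in `H` makes the `p`-adic integer a unit, so the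
multiplication extends to an automorphism of all of `A`. -/
theorem exists_mem_PAut_of_mem_zpowers (hA : IsPGroup p A) {γ : MulAut A} {H : Subgroup A}
    (hH : H ≠ ⊥) (hγ : ∀ z ∈ H, γ z ∈ Subgroup.zpowers z) : ∃ α ∈ PAut A, ∀ z ∈ H, γ z = α z := by
  obtain ⟨n, hn, h⟩ := exists_isCompatible (φ := γ.toMonoidHom) hA hγ
  have h1 : ¬ (p : ℤ) ∣ n 1 := by
    rintro ⟨l, hl⟩
    obtain ⟨x, hx, hx1, hxp⟩ := exists_pow_eq_one_of_ne_bot hA hH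
    have h2 := h x hx 1 (by rwa [pow_one])
    rw [hl, zpow_mul, zpow_natCast, hxp, one_zpow] at h2
    exact hx1 (γ.injective (h2.trans (map_one γ).symm))
  obtain ⟨α, hα, hαn⟩ := hn.exists_mulAut hA h1
  refine ⟨α, hα, fun z hz => ?_⟩
  obtain ⟨k, hk⟩ := hA z
  exact (h z hz k hk).trans (hαn z k hk).symm

theorem hasFiniteSocle_range (hA : IsPGroup p A) {H : Subgroup A} (hH : HasFiniteSocle p (A ⧸ H))
    {f : A →* C} (hf : H ≤ f.ker) : HasFiniteSocle p f.range := by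
  refine hH.of_surjective (hA.to_quotient H) (f := QuotientGroup.lift H f.rangeRestrict ?_) ?_
  · intro a ha
    exact Subtype.ext (hf ha)
  · exact QuotientGroup.lift_surjective_of_surjective _ _ f.rangeRestrict_surjective _

/-- A crude bound: the order `p ^ l` is at most `N`, so `l < p ^ l ≤ N`. -/
theorem pow_prime_pow_eq_one (hA : IsPGroup p A) {a : A} {N : ℕ} (hN : N ≠ 0) (h : a ^ N = 1) :
    a ^ p ^ N = 1 := by
  have hp : p.Prime := Fact.out
  obtain ⟨l, hl⟩ := IsPGroup.iff_orderOf.1 hA a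
  have h1 := Nat.le_of_dvd (Nat.pos_of_ne_zero hN) (orderOf_dvd_of_pow_eq_one h)
  have h2 : l < p ^ l := Nat.lt_pow_self hp.one_lt
  exact pow_eq_one_of_le (show l ≤ N by omega) (by rw [← hl]; exact pow_orderOf_eq_one a)

theorem exists_mul_eq_of_div_mem {α γ : MulAut A} (h : α⁻¹ * γ ∈ FAut A) :
    ∃ f ∈ FAut A, γ = α * f := ⟨_, h, (mul_inv_cancel_left α γ).symm⟩

/-- `B ^ (p ^ j)` is reduced with finite socle, hence finite, and its order bounds it. -/
theorem isBddExponent_of_hasFiniteSocle (hA : IsPGroup p A) {B : Subgroup A}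
    (hB : Disjoint (divPart A) B) {j : ℕ}
    (h : HasFiniteSocle p (powMonoidHom (p ^ j) : A →* A).range) : IsBddExponent B := by
  have hp : p.Prime := Fact.out
  set X := B.map (powMonoidHom (p ^ j)) with hX
  have hXr : X ≤ (powMonoidHom (p ^ j) : A →* A).range := by
    rintro _ ⟨b, -, rfl⟩
    exact ⟨b, rfl⟩
  have hXB : X ≤ B := by
    rintro _ ⟨b, hb, rfl⟩
    exact pow_mem hb _
  have hXs : HasFiniteSocle p X := h.of_injective (Subgroup.inclusion_injective hXr)
  have hXf : Finite X := hXs.finite_of_reduced (hA.to_subgroup X) fun H hH =>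
    eq_bot_of_isDivisible_subgroup (hB.mono_right hXB) hH
  refine ⟨p ^ j * Nat.card X, mul_ne_zero (pow_ne_zero _ hp.ne_zero) Nat.card_pos.ne',
    fun b hb => ?_⟩
  rw [pow_mul]
  exact congrArg Subtype.val (pow_card_eq_one' (x := (⟨_, ⟨b, hb, rfl⟩⟩ : X)))

/-- Take `H` with `A/H` of finite socle on which `φ` is a power map. If `H` is bounded, some `A ^ (p
^ j)` has finite socle, so `D` has finite rank and `B` is bounded; non-criticality makes `B` finite.
If `H` is unbounded, boundedness of `φ` forces it to vanish on `H`. -/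
theorem IsInertEnd.finite_range_of_not_isCritical (hA : IsPGroup p A) (hcrit : ¬ IsCritical A)
    {φ : A →* A} (hφ : IsInertEnd φ) (hne : divPart A ≠ ⊥) (hφD : ∀ d ∈ divPart A, φ d = 1) :
    Finite φ.range := by
  have hp : p.Prime := Fact.out
  have hD := isDivisible_divPart A
  obtain ⟨N, hN, hφN⟩ := hφ.exists_pow_eq_one hA hD hne hφD
  obtain ⟨H, hH, hφH⟩ := hφ.exists_subgroup hA
  obtain ⟨B, hB⟩ := exists_isCompl_divPart hA
  by_cases hb : ∃ j, ∀ x ∈ H, x ^ p ^ j = 1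
  · obtain ⟨j, hj⟩ := hb
    have hs := hasFiniteSocle_range hA hH (f := powMonoidHom (p ^ j)) hj
    have hDr : divPart A ≤ (powMonoidHom (p ^ j) : A →* A).range := fun d hd => by
      obtain ⟨e, -, he⟩ := hD (p ^ j) (pow_ne_zero _ hp.ne_zero) d hd
      exact ⟨e, he⟩
    have hDs : HasFiniteSocle p (divPart A) := hs.of_injective (Subgroup.inclusion_injective hDr)
    have hBf : Finite B := by
      by_contra hBi
      rw [not_finite_iff_infinite] at hBi
      exact hcrit ⟨divPart A, B, hB, hne, hD, (hasFiniteRank_iff_hasFiniteSocle hA _).2 hDs, hBi,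
        isBddExponent_of_hasFiniteSocle hA hB.disjoint hs⟩
    refine ((Set.toFinite (B : Set A)).image φ).subset ?_
    rintro _ ⟨a, rfl⟩
    have ha : a ∈ divPart A ⊔ B := by rw [hB.sup_eq_top]; trivial
    obtain ⟨d, hd, b, hb, rfl⟩ := Subgroup.mem_sup.1 ha
    exact ⟨b, hb, by rw [map_mul, hφD d hd, one_mul]⟩
  · push Not at hb
    obtain ⟨n, -, hn⟩ := exists_isCompatible hA hφH
    have hker : H ≤ φ.ker := by
      intro x hx
      obtain ⟨k, hk⟩ := hA x
      have hxk := pow_eq_one_of_le (show k ≤ k + N + 1 by omega) hk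
      -- As `φ y` is killed by `p ^ N`, an element `y` of order `p ^ (k + N + 1)` shows that the
      -- exponent is divisible by `p ^ (k + 1)`, which kills `x`.
      obtain ⟨y, hy, hyo⟩ := exists_orderOf_eq_of_pow_ne_one hA (hb (k + N))
      have h1 : φ y = y ^ n (k + N + 1) :=
        hn y hy _ (by rw [← hyo]; exact pow_orderOf_eq_one y)
      have h2 : (φ y) ^ p ^ N = 1 := pow_prime_pow_eq_one hA hN (hφN y)
      rw [h1, ← zpow_natCast, ← zpow_mul, ← orderOf_dvd_iff_zpow_eq_one, hyo,
        show k + N + 1 = (k + 1) + N by omega, pow_add p, Nat.cast_mul] at h2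
      have h3 := (mul_dvd_mul_iff_right
        (by exact_mod_cast pow_ne_zero _ hp.ne_zero : ((p ^ N : ℕ) : ℤ) ≠ 0)).1 h2
      have hxk1 := pow_eq_one_of_le (show k ≤ k + 1 by omega) hk
      rw [MonoidHom.mem_ker, hn x hx _ hxk, show k + N + 1 = (k + 1) + N by omega,
        ← zpow_zero x]
      exact zpow_eq_zpow_of_dvd_sub hxk1 (by rwa [sub_zero])
    have hs := hasFiniteSocle_range hA hH hker
    refine hs.finite_of_pow_eq_one (k := N) ?_
    rintro ⟨_, a, rfl⟩
    exact Subtype.ext (pow_prime_pow_eq_one hA hN (hφN a))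

/-- In a non-critical abelian `p`-group every inertial automorphism is the product of a power
automorphism and a finitary one. -/
theorem IsInertial.exists_mul_eq (hA : IsPGroup p A) (hcrit : ¬ IsCritical A) {γ : MulAut A}
    (hγ : IsInertial γ) : ∃ α ∈ PAut A, ∃ f ∈ FAut A, γ = α * f := by
  by_cases hne : divPart A = ⊥
  · obtain ⟨H, hH, hγH⟩ := (isInertial_iff.1 hγ).exists_subgroup hA
    have hred : ∀ X : Subgroup A, Disjoint (divPart A) X := fun X => by
      rw [hne]; exact disjoint_bot_left
    by_cases hHb : H = ⊥
    · subst hHb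
      have hs : HasFiniteSocle p A := hH.of_injective
        (f := (QuotientGroup.quotientBot (G := A)).symm.toMonoidHom) (MulEquiv.injective _)
      have : Finite A := hs.finite_of_reduced hA fun X hX =>
        eq_bot_iff.2 (((isGreatest_divPart A).2 hX).trans hne.le)
      exact ⟨1, one_mem _, γ, ⟨⊥, inferInstance, fun a ha => by
        rw [Subgroup.mem_bot.1 ha, map_one]⟩, (one_mul γ).symm⟩
    · obtain ⟨α, hα, h⟩ := exists_mem_PAut_of_mem_zpowers hA hHb hγH
      refine ⟨α, hα, exists_mul_eq_of_div_mem (mem_FAut_iff.2 ?_)⟩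
      have hs := hasFiniteSocle_range hA hH
        (f := (α⁻¹ * γ).toMonoidHom / MonoidHom.id A) (fun x hx => by
          rw [MonoidHom.mem_ker, MonoidHom.div_apply, div_eq_one]
          show α⁻¹ (γ x) = x
          rw [h x hx]
          exact MulAut.inv_apply_self A α x)
      exact hs.finite_of_reduced (hA.to_subgroup _) fun X hX =>
        eq_bot_of_isDivisible_subgroup (hred _) hX
  · have hD := isDivisible_divPart A
    obtain ⟨α, hα, h⟩ := exists_mem_PAut_of_mem_zpowers hA hne (γ := γ) fun z hz =>
      (isInertial_iff.1 hγ).mem_zpowers_of_isDivisible hA hD hz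
    refine ⟨α, hα, exists_mul_eq_of_div_mem (mem_FAut_iff.2 ?_)⟩
    have hin := isInertial_iff.1 (isInertial_mul_of_mem_PAut (inv_mem hα) hγ)
    refine (isInertEnd_div_id_iff.2 hin).finite_range_of_not_isCritical hA hcrit hne fun d hd => ?_
    rw [MonoidHom.div_apply, div_eq_one]
    show α⁻¹ (γ d) = d
    rw [h d hd]
    exact MulAut.inv_apply_self A α d

theorem IAut_eq_of_not_isCritical (hA : IsPGroup p A) (hcrit : ¬ IsCritical A) :
    (IAut A : Set (MulAut A)) = (PAut A : Set (MulAut A)) * (FAut A : Set (MulAut A)) := by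
  have := normal_PAut hA
  rw [← Subgroup.normal_mul]
  congr 1
  refine le_antisymm ((Subgroup.closure_le _).2 ?_) (sup_le PAut_le_IAut FAut_le_IAut)
  intro γ hγ
  obtain ⟨α, hα, f, hf, rfl⟩ := IsInertial.exists_mul_eq hA hcrit hγ
  exact Subgroup.mul_mem_sup hα hf

theorem sInf_image_coe_eq_coe {S : Set ℕ} {m : ℕ} :
    sInf ((fun k : ℕ => (k : ℕ∞)) '' S) = m ↔ IsLeast S m := by
  constructor
  · intro h
    have hne : S.Nonempty := by
      by_contra h0
      rw [Set.not_nonempty_iff_eq_empty.1 h0, Set.image_empty, sInf_empty] at h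
      exact ENat.top_ne_natCast m h
    obtain ⟨k, hk, hkm⟩ := csInf_mem (hne.image fun k : ℕ => (k : ℕ∞))
    rw [h] at hkm
    have hkm' : k = m := Nat.cast_injective hkm
    subst hkm'
    refine ⟨hk, fun j hj => ?_⟩
    have : sInf ((fun k : ℕ => (k : ℕ∞)) '' S) ≤ (j : ℕ∞) := sInf_le ⟨j, hj, rfl⟩
    rw [h] at this
    exact_mod_cast this
  · rintro ⟨h1, h2⟩
    refine le_antisymm (sInf_le ⟨m, h1, rfl⟩) (le_sInf ?_)
    rintro _ ⟨j, hj, rfl⟩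
    exact Nat.cast_le.2 (h2 hj)

theorem not_exists_of_pExp_eq_top {G : Type*} [Group G] (h : pExp p G = ⊤) (m : ℕ) :
    ∃ g : G, g ^ p ^ m ≠ 1 := by
  by_contra hcon
  push Not at hcon
  have : pExp p G ≤ (m : ℕ∞) := sInf_le ⟨m, hcon, rfl⟩
  rw [h, top_le_iff] at this
  exact ENat.natCast_ne_top m this

/-- A subgroup of finite index in an unbounded group is unbounded, and a `p`-adic multiplication
trivial on it is trivial. -/
theorem PAut_inf_FAut_eq_bot (hA : IsPGroup p A) (h : pExp p A = ⊤) : PAut A ⊓ FAut A = ⊥ := by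
  rw [eq_bot_iff]
  rintro γ ⟨hγ, K, hK, hfix⟩
  refine Subgroup.mem_bot.2 (eq_one_of_mem_PAut hA hγ (fun k => ?_) hfix)
  obtain ⟨a, ha⟩ := not_exists_of_pExp_eq_top h (k + K.index)
  refine ⟨a ^ K.index, K.pow_index_mem a, fun h1 => ha ?_⟩
  rw [← pow_mul, mul_comm, pow_mul] at h1
  rw [pow_add, pow_mul]
  exact pow_prime_pow_eq_one hA hK.index_ne_zero h1

theorem PAut_inf_FAut_of_finite [Finite A] : PAut A ⊓ FAut A = PAut A :=
  inf_eq_left.2 fun γ _ => ⟨⊥, inferInstance, fun a ha => by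
    rw [Subgroup.mem_bot.1 ha, map_one]⟩

end NonCritical

/-! ### Bounded groups: power automorphisms as units modulo `p ^ m` -/

section Units

variable {A : Type*} [CommGroup A]

theorem pow_val_mul {N : ℕ} (hN : ∀ a : A, a ^ N = 1) (u v : ZMod N) (a : A) :
    a ^ (u * v).val = (a ^ v.val) ^ u.val := by
  rw [ZMod.val_mul, ← pow_mul, mul_comm v.val]
  exact (pow_eq_pow_mod _ (hN a)).symm

theorem pow_val_one {N : ℕ} (hN : ∀ a : A, a ^ N = 1) (a : A) :
    a ^ (1 : ZMod N).val = a := by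
  rw [ZMod.val_one_eq_one_mod, ← pow_eq_pow_mod _ (hN a), pow_one]

/-- The units of `ZMod N` act on a group of exponent dividing `N`. -/
def unitsPow {N : ℕ} (hN : ∀ a : A, a ^ N = 1) : (ZMod N)ˣ →* MulAut A where
  toFun u :=
    { toFun := fun a => a ^ (u : ZMod N).val
      invFun := fun a => a ^ ((u⁻¹ : (ZMod N)ˣ) : ZMod N).val
      left_inv := fun a => (pow_val_mul hN _ _ a).symm.trans (by rw [Units.inv_mul, pow_val_one hN])
      right_inv := fun a => (pow_val_mul hN _ _ a).symm.trans (by rw [Units.mul_inv, pow_val_one hN])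
      map_mul' := fun a b => mul_pow a b _ }
  map_one' := MulEquiv.ext fun a => pow_val_one hN a
  map_mul' u v := MulEquiv.ext fun a => pow_val_mul hN u v a

theorem unitsPow_apply {N : ℕ} (hN : ∀ a : A, a ^ N = 1) (u : (ZMod N)ˣ) (a : A) :
    unitsPow hN u a = a ^ (u : ZMod N).val := rfl

theorem unitsPow_apply_of_eq {N : ℕ} [NeZero N] (hN : ∀ a : A, a ^ N = 1) (u : (ZMod N)ˣ) {n : ℤ}
    (hn : (n : ZMod N) = u) (a : A) : unitsPow hN u a = a ^ n := by
  rw [unitsPow_apply, ← zpow_natCast]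
  refine zpow_eq_zpow_of_dvd_sub (hN a) ?_
  rw [← ZMod.intCast_zmod_eq_zero_iff_dvd]
  push_cast
  rw [ZMod.natCast_zmod_val, hn, sub_self]

variable {p : ℕ} [Fact p.Prime]

theorem isPGroup_of_pow_eq_one {m : ℕ} (hN : ∀ a : A, a ^ p ^ m = 1) : IsPGroup p A :=
  fun a => ⟨m, hN a⟩

theorem isUnit_intCast_of_not_dvd (m : ℕ) {n : ℤ} (hn : ¬ (p : ℤ) ∣ n) :
    IsUnit (n : ZMod (p ^ m)) := by
  have hp : p.Prime := Fact.out
  have hc : IsCoprime n ((p ^ m : ℕ) : ℤ) := by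
    rw [Nat.cast_pow]
    exact (((Nat.prime_iff_prime_int.1 hp).coprime_iff_not_dvd).2 hn).symm.pow_right
  obtain ⟨u, v, huv⟩ := hc
  refine IsUnit.of_mul_eq_one (u : ZMod (p ^ m)) ?_
  have := congrArg (Int.cast : ℤ → ZMod (p ^ m)) huv
  rw [Int.cast_add, Int.cast_mul, Int.cast_mul, Int.cast_natCast, ZMod.natCast_self, mul_zero,
    add_zero, Int.cast_one] at this
  rwa [mul_comm]

theorem exists_orderOf_eq_of_isLeast (hA : IsPGroup p A) {m : ℕ}
    (hm : IsLeast {m | ∀ a : A, a ^ p ^ m = 1} m) : ∃ x : A, orderOf x = p ^ m := by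
  cases m with
  | zero => exact ⟨1, by simp⟩
  | succ k =>
    have : ∃ x ∈ (⊤ : Subgroup A), x ^ p ^ k ≠ 1 := by
      by_contra hcon
      push Not at hcon
      have := hm.2 (show k ∈ _ from fun a => hcon a trivial)
      omega
    obtain ⟨x, -, hx⟩ := exists_orderOf_eq_of_pow_ne_one hA this
    exact ⟨x, hx⟩

theorem unitsPow_injective {m : ℕ} (hm : IsLeast {m | ∀ a : A, a ^ p ^ m = 1} m) :
    Function.Injective (unitsPow hm.1) := by
  have hp : p.Prime := Fact.out
  have : NeZero (p ^ m) := ⟨pow_ne_zero _ hp.ne_zero⟩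
  obtain ⟨x, hx⟩ := exists_orderOf_eq_of_isLeast (isPGroup_of_pow_eq_one hm.1) hm
  intro u v huv
  have h1 : x ^ (u : ZMod (p ^ m)).val = x ^ (v : ZMod (p ^ m)).val :=
    congrArg (fun f : MulAut A => f x) huv
  exact Units.ext (ZMod.val_injective _ (pow_injOn_Iio_orderOf
    (by rw [hx]; exact ZMod.val_lt _) (by rw [hx]; exact ZMod.val_lt _) h1))

theorem unitsPow_mem_PAut {m : ℕ} (hN : ∀ a : A, a ^ p ^ m = 1) (u : (ZMod (p ^ m))ˣ) :
    unitsPow hN u ∈ PAut A :=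
  isPower_of_mem_zpowers (isPGroup_of_pow_eq_one hN) fun a =>
    Subgroup.npow_mem_zpowers a _

theorem exists_int_of_mem_PAut {m : ℕ} (hN : ∀ a : A, a ^ p ^ m = 1) {γ : MulAut A}
    (hγ : γ ∈ PAut A) : ∃ n : ℤ, ¬ (p : ℤ) ∣ n ∧ ∀ a, γ a = a ^ n := by
  have hp : p.Prime := Fact.out
  have hA := isPGroup_of_pow_eq_one hN
  by_cases hbot : (⊤ : Subgroup A) = ⊥
  · refine ⟨1, fun h => hp.one_lt.ne' ?_, fun a => ?_⟩
    · exact_mod_cast Int.eq_one_of_dvd_one (by positivity) h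
    · have h1 : ∀ b : A, b = 1 := fun b => Subgroup.mem_bot.1 (hbot ▸ trivial)
      rw [h1 (γ a), h1 (a ^ (1 : ℤ))]
  · obtain ⟨n, -, h⟩ := exists_isCompatible_of_mem_PAut hA hγ
    refine ⟨n m, ?_, fun a => h a m (hN a)⟩
    rintro ⟨l, hl⟩
    obtain ⟨x, -, hx1, hxp⟩ := exists_pow_eq_one_of_ne_bot hA hbot
    have h2 := h x m (hN x)
    rw [hl, zpow_mul, zpow_natCast, hxp, one_zpow] at h2
    exact hx1 (γ.injective (h2.trans (map_one γ).symm))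

theorem range_unitsPow {m : ℕ} (hN : ∀ a : A, a ^ p ^ m = 1) : (unitsPow hN).range = PAut A := by
  have hp : p.Prime := Fact.out
  have : NeZero (p ^ m) := ⟨pow_ne_zero _ hp.ne_zero⟩
  refine le_antisymm ?_ fun γ hγ => ?_
  · rintro _ ⟨u, rfl⟩
    exact unitsPow_mem_PAut hN u
  · obtain ⟨n, hn, h⟩ := exists_int_of_mem_PAut hN hγ
    obtain ⟨u, hu⟩ := isUnit_intCast_of_not_dvd (p := p) m hn
    exact ⟨u, MulEquiv.ext fun a => (unitsPow_apply_of_eq hN u hu.symm a).trans (h a).symm⟩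

/-- With `n = u - 1`, being finitary means that the group of `n`-th powers is finite. It equals the
group of `p ^ v`-th powers for `p ^ v = gcd(n, p ^ m)`, so this says `e ≤ v`, that is, `u ≡ 1`
modulo `p ^ e`. -/
theorem unitsPow_mem_FAut_iff {m e : ℕ} (hN : ∀ a : A, a ^ p ^ m = 1)
    (he : IsLeast {e | (Set.range fun a : A => a ^ p ^ e).Finite} e) (hem : e ≤ m)
    (u : (ZMod (p ^ m))ˣ) :
    unitsPow hN u ∈ FAut A ↔ u ∈ (ZMod.unitsMap (pow_dvd_pow p hem)).ker := by
  have hp : p.Prime := Fact.out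
  have : NeZero (p ^ m) := ⟨pow_ne_zero _ hp.ne_zero⟩
  have : NeZero (p ^ e) := ⟨pow_ne_zero _ hp.ne_zero⟩
  set n : ℤ := ((u : ZMod (p ^ m)).val : ℤ) - 1 with hn
  have hdvd : u ∈ (ZMod.unitsMap (pow_dvd_pow p hem)).ker ↔ ((p ^ e : ℕ) : ℤ) ∣ n := by
    rw [MonoidHom.mem_ker, Units.ext_iff, ZMod.unitsMap_val, Units.val_one,
      ← ZMod.intCast_zmod_eq_zero_iff_dvd, hn]
    push_cast
    rw [sub_eq_zero, ZMod.cast_eq_val]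
  have hrange : (((unitsPow hN u).toMonoidHom / MonoidHom.id A).range : Set A) =
      Set.range fun a : A => a ^ n := by
    rw [MonoidHom.coe_range]
    congr 1
    funext a
    rw [MonoidHom.div_apply, hn, zpow_sub, zpow_natCast, zpow_one, div_eq_mul_inv]
    rfl
  have hfin : unitsPow hN u ∈ FAut A ↔ (Set.range fun a : A => a ^ n).Finite := by
    rw [mem_FAut_iff, ← hrange]
    rfl
  rw [hfin, hdvd]
  constructor
  · intro h
    obtain ⟨v, hv, hgcd⟩ := (Nat.dvd_prime_pow hp).1 (Int.gcd_dvd_natAbs_right n ((p ^ m : ℕ) : ℤ))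
    have hev : e ≤ v := by
      refine he.2 (show (Set.range fun a : A => a ^ p ^ v).Finite from ?_)
      refine (h.image fun b => b ^ Int.gcdA n ((p ^ m : ℕ) : ℤ)).subset ?_
      rintro _ ⟨a, rfl⟩
      refine ⟨a ^ n, ⟨a, rfl⟩, ?_⟩
      show (a ^ n) ^ _ = a ^ p ^ v
      rw [← zpow_natCast a, ← hgcd, Int.gcd_eq_gcd_ab, zpow_add, zpow_mul,
        zpow_mul a (_ : ℤ) (Int.gcdB _ _), zpow_natCast, hN, one_zpow, mul_one]
    refine dvd_trans ?_ (Int.gcd_dvd_left (a := n) (b := ((p ^ m : ℕ) : ℤ)))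
    rw [hgcd]
    exact_mod_cast pow_dvd_pow p hev
  · rintro ⟨l, hl⟩
    refine (he.1.image fun b => b ^ l).subset ?_
    rintro _ ⟨a, rfl⟩
    refine ⟨a ^ p ^ e, ⟨a, rfl⟩, ?_⟩
    show (a ^ p ^ e) ^ l = a ^ n
    rw [hl, zpow_mul, zpow_natCast]

theorem PAut_inf_FAut_eq_map {m e : ℕ} (hN : ∀ a : A, a ^ p ^ m = 1)
    (he : IsLeast {e | (Set.range fun a : A => a ^ p ^ e).Finite} e) (hem : e ≤ m) :
    PAut A ⊓ FAut A = ((ZMod.unitsMap (pow_dvd_pow p hem)).ker).map (unitsPow hN) := by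
  ext γ
  constructor
  · rintro ⟨h1, h2⟩
    rw [SetLike.mem_coe, ← range_unitsPow hN] at h1
    obtain ⟨u, rfl⟩ := h1
    exact ⟨u, (unitsPow_mem_FAut_iff hN he hem u).1 h2, rfl⟩
  · rintro ⟨u, hu, rfl⟩
    exact ⟨unitsPow_mem_PAut hN u, (unitsPow_mem_FAut_iff hN he hem u).2 hu⟩

/-- A quotient of two totients. For `e = 0` the target is trivial and the formula fails in general;
infinite groups have `e ≠ 0`. -/
theorem card_ker_unitsMap {m e : ℕ} (he : e ≠ 0) (hem : e ≤ m) :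
    Nat.card (ZMod.unitsMap (pow_dvd_pow p hem)).ker = p ^ (m - e) := by
  have hp : p.Prime := Fact.out
  have : NeZero (p ^ m) := ⟨pow_ne_zero _ hp.ne_zero⟩
  have : NeZero (p ^ e) := ⟨pow_ne_zero _ hp.ne_zero⟩
  have h1 := Subgroup.card_mul_index (ZMod.unitsMap (pow_dvd_pow p hem)).ker
  rw [Subgroup.index_ker, MonoidHom.range_eq_top.2 (ZMod.unitsMap_surjective _),
    Nat.card_congr Subgroup.topEquiv.toEquiv, Nat.card_eq_fintype_card (α := (ZMod (p ^ e))ˣ),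
    Nat.card_eq_fintype_card (α := (ZMod (p ^ m))ˣ), ZMod.card_units_eq_totient,
    ZMod.card_units_eq_totient, Nat.totient_prime_pow hp (Nat.pos_of_ne_zero he),
    Nat.totient_prime_pow hp (by omega)] at h1
  have hpos : 0 < p ^ (e - 1) * (p - 1) :=
    Nat.mul_pos (pow_pos hp.pos _) (Nat.sub_pos_of_lt hp.one_lt)
  refine Nat.eq_of_mul_eq_mul_right hpos (h1.trans ?_)
  rw [← mul_assoc, ← pow_add]
  congr 2
  omega

/-- The class of `5` is congruent to `1` modulo `4` and has order `2 ^ n`, the order of the kernel.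
-/
theorem isCyclic_ker_unitsMap_four (n : ℕ) :
    IsCyclic (ZMod.unitsMap (pow_dvd_pow 2 (show 2 ≤ n + 2 by omega))).ker := by
  have : Fact (Nat.Prime 2) := ⟨Nat.prime_two⟩
  have : NeZero (2 ^ (n + 2)) := ⟨by positivity⟩
  obtain ⟨u, hu⟩ : IsUnit (5 : ZMod (2 ^ (n + 2))) := by
    have := isUnit_intCast_of_not_dvd (p := 2) (n + 2) (n := 5) (by norm_num)
    simpa using this
  have hmem : u ∈ (ZMod.unitsMap (pow_dvd_pow 2 (show 2 ≤ n + 2 by omega))).ker := by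
    rw [MonoidHom.mem_ker, Units.ext_iff, ZMod.unitsMap_val, hu, Units.val_one]
    have h := map_ofNat (ZMod.castHom (pow_dvd_pow 2 (show 2 ≤ n + 2 by omega)) (ZMod (2 ^ 2))) 5
    rw [ZMod.castHom_apply] at h
    rw [h]
    decide
  have hord : orderOf u = 2 ^ n := by
    rw [← orderOf_units, hu, ZMod.orderOf_five]
  refine isCyclic_of_orderOf_eq_card (⟨u, hmem⟩ :
    (ZMod.unitsMap (pow_dvd_pow 2 (show 2 ≤ n + 2 by omega))).ker) ?_
  rw [Subgroup.orderOf_mk, hord, card_ker_unitsMap (p := 2) two_ne_zero (show 2 ≤ n + 2 by omega)]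
  rfl

theorem isCyclic_ker_unitsMap_iff {m e : ℕ} (he : e ≠ 0) (hem : e ≤ m) :
    IsCyclic (ZMod.unitsMap (pow_dvd_pow p hem)).ker ↔ ¬ (p = 2 ∧ e = 1 ∧ 3 ≤ m) := by
  have hp : p.Prime := Fact.out
  by_cases hp2 : p = 2
  · subst hp2
    rcases eq_or_ne e 1 with rfl | he1
    -- Modulo `2` there is only one unit, so the kernel is the whole unit group modulo `2 ^ m`,
    -- which is not cyclic from `m = 3` on.
    · have htop : (ZMod.unitsMap (pow_dvd_pow 2 hem)).ker = ⊤ := by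
        rw [eq_top_iff]
        intro u _
        rw [MonoidHom.mem_ker]
        generalize ZMod.unitsMap (pow_dvd_pow 2 hem) u = v
        revert v
        decide
      rw [htop, Subgroup.topEquiv.isCyclic, ZMod.isCyclic_units_two_pow_iff]
      simp only [true_and, not_le]
      omega
    · obtain ⟨n, rfl⟩ : ∃ n, m = n + 2 := ⟨m - 2, by omega⟩
      simp only [he1, false_and, and_false, not_false_eq_true, iff_true]
      have := isCyclic_ker_unitsMap_four n
      refine isCyclic_of_injective (Subgroup.inclusion (H := (ZMod.unitsMap (pow_dvd_pow 2 hem)).ker)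
        (K := (ZMod.unitsMap (pow_dvd_pow 2 (show 2 ≤ n + 2 by omega))).ker) ?_)
        (Subgroup.inclusion_injective _)
      intro u hu
      rw [MonoidHom.mem_ker] at hu ⊢
      have h := ZMod.unitsMap_comp (pow_dvd_pow 2 (show 2 ≤ e by omega)) (pow_dvd_pow 2 hem)
      rw [← h, MonoidHom.comp_apply, hu, map_one]
  · simp only [hp2, false_and, not_false_eq_true, iff_true]
    have := ZMod.isCyclic_units_of_prime_pow p hp hp2 m
    infer_instance

theorem ne_zero_of_isLeast [Infinite A] {e : ℕ}
    (he : IsLeast {e | (Set.range fun a : A => a ^ p ^ e).Finite} e) : e ≠ 0 := by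
  rintro rfl
  have := he.1
  simp only [Set.mem_ofPred_eq, pow_zero, pow_one, Set.range_id'] at this
  exact Set.infinite_univ this

theorem le_of_isLeast {m e : ℕ} (hN : ∀ a : A, a ^ p ^ m = 1)
    (he : IsLeast {e | (Set.range fun a : A => a ^ p ^ e).Finite} e) : e ≤ m :=
  he.2 (show (Set.range fun a : A => a ^ p ^ m).Finite by
    simp only [hN]
    exact (Set.finite_singleton (1 : A)).subset Set.range_const_subset)

theorem card_PAut_inf_FAut [Infinite A] {m e : ℕ} (hm : pExp p A = m) (he : eExp p A = e) :
    Nat.card ↥(PAut A ⊓ FAut A) = p ^ (m - e) := by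
  have hm' := sInf_image_coe_eq_coe.1 hm
  have he' := sInf_image_coe_eq_coe.1 he
  have hem := le_of_isLeast hm'.1 he'
  rw [PAut_inf_FAut_eq_map hm'.1 he' hem,
    Subgroup.card_map_of_injective (unitsPow_injective hm'),
    card_ker_unitsMap (ne_zero_of_isLeast he') hem]

theorem isCyclic_PAut_inf_FAut_iff [Infinite A] {m e : ℕ} (hm : pExp p A = m)
    (he : eExp p A = e) :
    IsCyclic ↥(PAut A ⊓ FAut A) ↔ ¬ (p = 2 ∧ e = 1 ∧ 3 ≤ m) := by
  have hm' := sInf_image_coe_eq_coe.1 hm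
  have he' := sInf_image_coe_eq_coe.1 he
  have hem := le_of_isLeast hm'.1 he'
  rw [PAut_inf_FAut_eq_map hm'.1 he' hem,
    ← (Subgroup.equivMapOfInjective _ _ (unitsPow_injective hm')).isCyclic,
    isCyclic_ker_unitsMap_iff (ne_zero_of_isLeast he') hem]

end Units

/-! ### Automorphisms of `D ⊕ B` trivial on `D`; the stability group as `Hom(B, D)` -/

section Projections

variable {A : Type*} [CommGroup A] {D B : Subgroup A} (h : IsCompl D B)

/-- The projection of `A = D ⊕ B` onto `D`. -/
noncomputable def projLeft : A →* D := (MonoidHom.fst D B).comp (prodEquiv h).symm.toMonoidHom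

/-- The projection of `A = D ⊕ B` onto `B`. -/
noncomputable def projRight : A →* B := (MonoidHom.snd D B).comp (prodEquiv h).symm.toMonoidHom

theorem projLeft_mul_projRight (a : A) : (projLeft h a : A) * projRight h a = a :=
  (prodEquiv h).apply_symm_apply a

theorem prodEquiv_symm_mul (d : D) (b : B) : (prodEquiv h).symm ((d : A) * b) = (d, b) :=
  (prodEquiv h).symm_apply_apply (d, b)

theorem projRight_mul (d : D) (b : B) : projRight h ((d : A) * b) = b :=
  congrArg Prod.snd (prodEquiv_symm_mul h d b)

theorem projRight_coe (b : B) : projRight h b = b := by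
  have := projRight_mul h 1 b
  rwa [Subgroup.coe_one, one_mul] at this

theorem projRight_eq_one_iff {a : A} : projRight h a = 1 ↔ a ∈ D := by
  constructor
  · intro ha
    rw [← projLeft_mul_projRight h a, ha, Subgroup.coe_one, mul_one]
    exact (projLeft h a).2
  · intro ha
    have := projRight_mul h ⟨a, ha⟩ 1
    rwa [Subgroup.coe_one, mul_one] at this

theorem oneSum_apply' (γ : MulAut B) (a : A) :
    oneSum h γ a = projLeft h a * γ (projRight h a) := by
  conv_lhs => rw [← projLeft_mul_projRight h a]
  exact oneSum_apply h γ _ _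

theorem projRight_oneSum (γ : MulAut B) (a : A) :
    projRight h (oneSum h γ a) = γ (projRight h a) := by
  rw [oneSum_apply', projRight_mul]

theorem oneSum_apply_left (γ : MulAut B) {d : A} (hd : d ∈ D) : oneSum h γ d = d := by
  have := oneSum_apply h γ ⟨d, hd⟩ 1
  rwa [map_one, Subgroup.coe_one, mul_one] at this

theorem oneSum_apply_right (γ : MulAut B) (b : B) : oneSum h γ b = γ b := by
  have := oneSum_apply h γ 1 b
  rwa [Subgroup.coe_one, one_mul, one_mul] at this

theorem oneSum_injective : Function.Injective (oneSum h) := by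
  intro f g hfg
  ext b
  rw [← oneSum_apply_right h, ← oneSum_apply_right h, hfg]

theorem oneSum_mem_FAut_iff {γ : MulAut B} : oneSum h γ ∈ FAut A ↔ γ ∈ FAut B := by
  constructor
  · rintro ⟨K, hK, hfix⟩
    refine ⟨K.subgroupOf B, inferInstance, fun b hb => Subtype.ext ?_⟩
    rw [← oneSum_apply_right h]
    exact hfix b hb
  · rintro ⟨K, hK, hfix⟩
    refine ⟨K.comap (projRight h), ⟨?_⟩, fun a ha => ?_⟩
    · rw [Subgroup.index_comap_of_surjective K (f := projRight h) fun b => ⟨b, projRight_coe h b⟩]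
      exact hK.index_ne_zero
    · rw [oneSum_apply', hfix _ ha, projLeft_mul_projRight]

theorem isOneSumInt_iff {δ : MulAut A} {n : ℤ} {α : MulAut B} (hα : ∀ b, α b = b ^ n) :
    IsOneSumInt D B n δ ↔ δ = oneSum h α := by
  constructor
  · intro hδ
    ext a
    rw [oneSum_apply', hα]
    conv_lhs => rw [← projLeft_mul_projRight h a]
    rw [hδ _ (projLeft h a).2 _ (projRight h a).2, Subgroup.coe_zpow]
  · rintro rfl d hd b hb
    have := oneSum_apply h α ⟨d, hd⟩ ⟨b, hb⟩
    rw [hα, Subgroup.coe_zpow] at this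
    exact this

/-- An automorphism that is trivial on `D` induces an automorphism of `B`. -/
theorem exists_projRight_apply {γ : MulAut A} (hγ : ∀ d ∈ D, γ d = d) :
    ∃ γ₀ : MulAut B, ∀ a, projRight h (γ a) = γ₀ (projRight h a) := by
  have key : ∀ f : MulAut A, (∀ d ∈ D, f d = d) → ∀ a,
      projRight h (f a) = projRight h (f (projRight h a)) := by
    intro f hf a
    conv_lhs => rw [← projLeft_mul_projRight h a]
    rw [map_mul, map_mul, hf _ (projLeft h a).2,
      (projRight_eq_one_iff h).2 (projLeft h a).2, one_mul]
  have hγ' : ∀ d ∈ D, γ⁻¹ d = d := fun d hd => by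
    conv_lhs => rw [← hγ d hd]
    exact MulAut.inv_apply_self A γ d
  refine ⟨MonoidHom.toMulEquiv (((projRight h).comp γ.toMonoidHom).comp B.subtype)
    (((projRight h).comp (γ⁻¹).toMonoidHom).comp B.subtype) ?_ ?_, key γ hγ⟩
  · ext1 b
    show projRight h (γ⁻¹ (projRight h (γ b))) = b
    rw [← key _ hγ', MulAut.inv_apply_self, projRight_coe]
  · ext1 b
    show projRight h (γ (projRight h (γ⁻¹ b))) = b
    rw [← key _ hγ, MulAut.apply_inv_self, projRight_coe]

theorem mem_St_iff {σ : MulAut A} :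
    σ ∈ St D ↔ (∀ a, projRight h (σ a) = projRight h a) ∧ ∀ d ∈ D, σ d = d := by
  refine and_congr_left fun _ => forall_congr' fun a => ?_
  rw [← projRight_eq_one_iff h, map_mul, map_inv, inv_mul_eq_one, eq_comm]

/-- The source of the semidirect decompositions: removing the induced action on `B` leaves an
element of the stability group. -/
theorem mul_oneSum_inv_mem_St {γ : MulAut A} (hγ : ∀ d ∈ D, γ d = d) {γ₀ : MulAut B}
    (hγ₀ : ∀ a, projRight h (γ a) = γ₀ (projRight h a)) : γ * (oneSum h γ₀)⁻¹ ∈ St D := by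
  rw [← map_inv, mem_St_iff h]
  refine ⟨fun a => ?_, fun d hd => ?_⟩
  · rw [MulAut.mul_apply, hγ₀, projRight_oneSum, MulAut.apply_inv_self]
  · rw [MulAut.mul_apply, oneSum_apply_left h _ hd, hγ d hd]

theorem apply_eq_projRight {γ : MulAut A} {γ₀ : MulAut B}
    (hγ₀ : ∀ a, projRight h (γ a) = γ₀ (projRight h a)) (b : B) :
    γ₀ b = projRight h (γ b) := by rw [hγ₀, projRight_coe]

theorem isInertial_of_projRight {γ : MulAut A} {γ₀ : MulAut B}
    (hγ₀ : ∀ a, projRight h (γ a) = γ₀ (projRight h a)) (hγ : IsInertial γ) : IsInertial γ₀ := by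
  rw [isInertial_iff] at hγ ⊢
  intro H
  have hle : H.map B.subtype ≤ H.comap (projRight h) := by
    rintro _ ⟨b, hb, rfl⟩
    show projRight h b ∈ H
    rwa [projRight_coe]
  refine ((hγ (H.map B.subtype)).image (QuotientGroup.map _ _ (projRight h) hle)).subset ?_
  rintro _ ⟨b, hb, rfl⟩
  refine ⟨_, ⟨b, ⟨b, hb, rfl⟩, rfl⟩, ?_⟩
  rw [QuotientGroup.map_mk]
  exact congrArg _ (apply_eq_projRight h hγ₀ b).symm

theorem mem_FAut_of_projRight {γ : MulAut A} {γ₀ : MulAut B}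
    (hγ₀ : ∀ a, projRight h (γ a) = γ₀ (projRight h a)) (hγ : γ ∈ FAut A) : γ₀ ∈ FAut B := by
  obtain ⟨K, hK, hfix⟩ := hγ
  refine ⟨K.subgroupOf B, inferInstance, fun b hb => ?_⟩
  rw [apply_eq_projRight h hγ₀, hfix b hb, projRight_coe]

theorem St_inf_map_oneSum (Γ : Subgroup (MulAut B)) : St D ⊓ Γ.map (oneSum h) = ⊥ := by
  rw [eq_bot_iff]
  rintro _ ⟨hσ, γ₀, -, rfl⟩
  have : γ₀ = 1 := by
    ext1 b
    have := ((mem_St_iff h).1 hσ).1 b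
    rwa [projRight_oneSum, projRight_coe] at this
  rw [this, map_one]
  exact one_mem _

/-- The automorphism `a ↦ a * f b`, where `b` is the component of `a` in `B`. -/
noncomputable def shear (f : B →* D) : MulAut A where
  toFun a := a * f (projRight h a)
  invFun a := a * (f (projRight h a) : A)⁻¹
  left_inv a := by
    have : projRight h (a * f (projRight h a)) = projRight h a := by
      rw [map_mul, (projRight_eq_one_iff h).2 (f _).2, mul_one]
    simp only [this, mul_inv_cancel_right]
  right_inv a := by
    have : projRight h (a * ((f (projRight h a) : D) : A)⁻¹) = projRight h a := by
      rw [map_mul, map_inv, (projRight_eq_one_iff h).2 (f _).2, inv_one, mul_one]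
    simp only [this, inv_mul_cancel_right]
  map_mul' a b := by
    rw [map_mul, map_mul, Subgroup.coe_mul, mul_mul_mul_comm]

theorem shear_apply (f : B →* D) (a : A) : shear h f a = a * f (projRight h a) := rfl

theorem projRight_shear (f : B →* D) (a : A) : projRight h (shear h f a) = projRight h a := by
  rw [shear_apply, map_mul, (projRight_eq_one_iff h).2 (f _).2, mul_one]

theorem shear_mem_St (f : B →* D) : shear h f ∈ St D := by
  refine (mem_St_iff h).2 ⟨projRight_shear h f, fun d hd => ?_⟩
  rw [shear_apply, (projRight_eq_one_iff h).2 hd, map_one, Subgroup.coe_one, mul_one]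

/-- The stability group of `D` in `D ⊕ B` is isomorphic to `Hom(B, D)`. -/
noncomputable def stEquiv : (B →* D) ≃* St D :=
  MulEquiv.ofBijective
    (⟨⟨fun f => ⟨shear h f, shear_mem_St h f⟩, by
      refine Subtype.ext (MulEquiv.ext fun a => ?_)
      show a * (1 : A) = a
      rw [mul_one]⟩, fun f g => by
      refine Subtype.ext (MulEquiv.ext fun a => ?_)
      show shear h (f * g) a = shear h f (shear h g a)
      rw [shear_apply h f, projRight_shear, shear_apply, shear_apply, MonoidHom.mul_apply,
        Subgroup.coe_mul, mul_assoc, mul_comm (f _ : A)]⟩ : (B →* D) →* St D) <| by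
    constructor
    · intro f g hfg
      ext b
      have h1 : shear h f b = shear h g b := congrArg (fun σ : St D => (σ : MulAut A) b) hfg
      rw [shear_apply, shear_apply, mul_right_inj, projRight_coe] at h1
      exact h1
    · rintro ⟨σ, hσ⟩
      obtain ⟨h1, h2⟩ := hσ
      refine ⟨⟨⟨fun b => ⟨_, h1 b⟩, Subtype.ext (by simp)⟩, fun b c => Subtype.ext ?_⟩,
        Subtype.ext (MulEquiv.ext fun a => ?_)⟩
      · simp only [Subgroup.coe_mul, map_mul, mul_inv]
        exact mul_mul_mul_comm _ _ _ _
      · show a * ((projRight h a : A)⁻¹ * σ (projRight h a)) = σ a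
        conv_rhs => rw [← projLeft_mul_projRight h a]
        conv_lhs => rw [← projLeft_mul_projRight h a, projRight_mul]
        rw [map_mul, h2 _ (projLeft h a).2, mul_assoc, mul_inv_cancel_left]

theorem stEquiv_apply (f : B →* D) (a : A) :
    (stEquiv h f : MulAut A) a = a * f (projRight h a) := rfl

theorem mul_comm_of_St (h : IsCompl D B) (σ τ : St D) : σ * τ = τ * σ := by
  obtain ⟨f, rfl⟩ := (stEquiv h).surjective σ
  obtain ⟨g, rfl⟩ := (stEquiv h).surjective τ
  rw [← map_mul, mul_comm, map_mul]

end Projections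

/-! ### Conjugation on the stability group -/

section Conjugation

variable {A : Type*} [CommGroup A] {B : Subgroup A} (h : IsCompl (divPart A) B)

theorem conjSt_mul (γ γ' : MulAut A) : conjSt (γ * γ') = conjSt γ * conjSt γ' :=
  map_mul MulAut.conjNormal γ γ'

theorem conjSt_inv (γ : MulAut A) : conjSt γ⁻¹ = (conjSt γ)⁻¹ := map_inv MulAut.conjNormal γ

/-- On `Hom(B, D)` conjugation is precomposition with the inverse. This is why `1 ⊕ n` acts as the
inverse of `n`. -/
theorem conjSt_oneSum (γ : MulAut B) (f : B →* divPart A) :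
    conjSt (oneSum h γ) (stEquiv h f) = stEquiv h (f.comp (γ⁻¹).toMonoidHom) := by
  refine Subtype.ext (MulEquiv.ext fun a => ?_)
  have h1 : (conjSt (oneSum h γ) (stEquiv h f) : MulAut A) =
      oneSum h γ * stEquiv h f * (oneSum h γ)⁻¹ := MulAut.conjNormal_apply _ _
  rw [h1, MulAut.mul_apply, MulAut.mul_apply, stEquiv_apply, stEquiv_apply, map_mul,
    MulAut.apply_inv_self, oneSum_apply_left h _ (f _).2, ← map_inv, projRight_oneSum]
  rfl

theorem conjSt_oneSum_inv {α : MulAut B} {n : ℤ} (hα : ∀ b, α b = b ^ n) (σ : St (divPart A)) :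
    conjSt (oneSum h α)⁻¹ σ = σ ^ n := by
  obtain ⟨f, rfl⟩ := (stEquiv h).surjective σ
  rw [← map_inv, conjSt_oneSum, ← map_zpow]
  congr 1
  ext1 b
  show f ((α⁻¹)⁻¹ b) = (f ^ n) b
  rw [inv_inv, hα, map_zpow]
  rfl

theorem conjSt_oneSum_of_modEq {m : ℕ} {p : ℕ} (hN : ∀ b : B, b ^ p ^ m = 1) {α : MulAut B} {n : ℤ}
    (hα : ∀ b, α b = b ^ n) {k : ℤ} (hk : n * k ≡ 1 [ZMOD (p : ℤ) ^ m]) (σ : St (divPart A)) :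
    conjSt (oneSum h α) σ = σ ^ k := by
  have h1 : σ ^ p ^ m = 1 := by
    obtain ⟨f, rfl⟩ := (stEquiv h).surjective σ
    rw [← map_pow]
    have : f ^ p ^ m = 1 := by
      ext1 b
      show f b ^ p ^ m = 1
      rw [← map_pow, hN, map_one]
    rw [this, map_one]
  have h2 : conjSt (oneSum h α)⁻¹ (σ ^ k) = σ := by
    rw [conjSt_oneSum_inv h hα, ← zpow_mul, mul_comm]
    obtain ⟨l, hl⟩ := hk.symm.dvd
    rw [sub_eq_iff_eq_add.1 hl, zpow_add, zpow_mul, ← Nat.cast_pow, zpow_natCast, h1, one_zpow,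
      one_mul, zpow_one]
  conv_lhs => rw [← h2]
  rw [conjSt_inv]
  exact MulAut.apply_inv_self _ _ _

end Conjugation

/-! ### Exponents and finiteness of `Hom(B, D)` -/

section Homs

variable {p : ℕ} [Fact p.Prime] {A B C D : Type*} [CommGroup A] [CommGroup B] [CommGroup C]
  [CommGroup D]

theorem finite_hom (hD : HasFiniteSocle p D) [Finite C] {m : ℕ} (hC : ∀ c : C, c ^ p ^ m = 1) :
    Finite (C →* D) := by
  have : Finite {d : D | d ^ p ^ m = 1} := hD.finite_pow_eq_one m
  refine Finite.of_injective (β := C → {d : D | d ^ p ^ m = 1})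
    (fun f c => ⟨f c, show f c ^ p ^ m = 1 by rw [← map_pow, hC, map_one]⟩) fun f g hfg => ?_
  ext1 c
  exact congrArg Subtype.val (congrFun hfg c)

theorem forall_hom_pow_eq_one_iff (hsep : ∀ b : B, b ≠ 1 → ∃ f : B →* D, f b ≠ 1) (N : ℕ) :
    (∀ f : B →* D, f ^ N = 1) ↔ ∀ b : B, b ^ N = 1 := by
  constructor
  · intro h b
    by_contra hb
    obtain ⟨f, hf⟩ := hsep _ hb
    apply hf
    rw [map_pow]
    exact DFunLike.congr_fun (h f) b
  · intro h f
    ext1 b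
    show f b ^ N = 1
    rw [← map_pow, h, map_one]

/-- If there are finitely many `f ^ N`, then `b ^ N` is determined by their values at `b`, which lie
in the finite `p ^ m`-torsion of `D`. Conversely `f ^ N` depends only on the restriction of `f` to
the finite group of `N`-th powers. -/
theorem finite_range_hom_pow_iff (hD : HasFiniteSocle p D) {m : ℕ} (hB : ∀ b : B, b ^ p ^ m = 1)
    (hsep : ∀ b : B, b ≠ 1 → ∃ f : B →* D, f b ≠ 1) (N : ℕ) :
    (Set.range fun f : B →* D => f ^ N).Finite ↔ (Set.range fun b : B => b ^ N).Finite := by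
  constructor
  · intro h
    have hT : Finite (Set.range fun f : B →* D => f ^ N) := h
    have : Finite {d : D | d ^ p ^ m = 1} := hD.finite_pow_eq_one m
    set ev : B → (Set.range fun f : B →* D => f ^ N) → {d : D | d ^ p ^ m = 1} := fun b g =>
      ⟨g.1 b, show g.1 b ^ p ^ m = 1 by rw [← map_pow, hB, map_one]⟩ with hev
    have hfac : Function.FactorsThrough (fun b : B => b ^ N) ev := by
      intro b c hbc
      by_contra hne
      obtain ⟨f, hf⟩ := hsep (b ^ N / c ^ N) (fun h1 => hne (div_eq_one.1 h1))
      apply hf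
      rw [map_div, div_eq_one, map_pow, map_pow]
      exact congrArg Subtype.val (congrFun hbc ⟨f ^ N, f, rfl⟩)
    rw [← hfac.extend_comp fun _ => 1]
    exact (Set.finite_range _).subset (Set.range_comp_subset_range _ _)
  · intro h
    set P : B →* B := powMonoidHom N with hP
    have hfin : Finite P.range := h
    have := finite_hom (C := P.range) hD (m := m) fun c => Subtype.ext (hB c)
    refine (Set.finite_range fun g : P.range →* D => g.comp P.rangeRestrict).subset ?_
    rintro _ ⟨f, rfl⟩
    refine ⟨f.comp P.range.subtype, ?_⟩
    ext1 b
    show f (b ^ N) = f b ^ N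
    rw [map_pow]

theorem pExp_congr {G H : Type*} [Group G] [Group H] (e : G ≃* H) : pExp p G = pExp p H := by
  unfold pExp
  congr 2
  ext m
  constructor
  · intro h x
    rw [← e.apply_symm_apply x, ← map_pow, h, map_one]
  · intro h x
    rw [← e.symm_apply_apply x, ← map_pow, h, map_one]

theorem eExp_congr {G H : Type*} [Group G] [Group H] (e : G ≃* H) : eExp p G = eExp p H := by
  unfold eExp
  congr 2
  ext m
  have : (Set.range fun x : H => x ^ p ^ m) = e '' Set.range fun x : G => x ^ p ^ m := by
    rw [← Set.range_comp]
    ext y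
    constructor
    · rintro ⟨x, rfl⟩
      exact ⟨e.symm x, by simp⟩
    · rintro ⟨x, rfl⟩
      exact ⟨e x, by simp⟩
  show Set.Finite _ ↔ Set.Finite _
  rw [this, Set.finite_image_iff e.injective.injOn]

theorem pExp_hom (hsep : ∀ b : B, b ≠ 1 → ∃ f : B →* D, f b ≠ 1) :
    pExp p (B →* D) = pExp p B := by
  unfold pExp
  congr 2
  ext m
  exact forall_hom_pow_eq_one_iff hsep (p ^ m)

theorem eExp_hom (hD : HasFiniteSocle p D) {m : ℕ} (hB : ∀ b : B, b ^ p ^ m = 1)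
    (hsep : ∀ b : B, b ≠ 1 → ∃ f : B →* D, f b ≠ 1) : eExp p (B →* D) = eExp p B := by
  unfold eExp
  congr 2
  ext j
  exact finite_range_hom_pow_iff hD hB hsep (p ^ j)

theorem infinite_hom (hD : HasFiniteSocle p D) {m : ℕ} (hB : ∀ b : B, b ^ p ^ m = 1)
    (hsep : ∀ b : B, b ≠ 1 → ∃ f : B →* D, f b ≠ 1) [Infinite B] : Infinite (B →* D) := by
  rw [← not_finite_iff_infinite]
  intro hfin
  have := (finite_range_hom_pow_iff hD hB hsep 1).1 (Set.toFinite _)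
  simp only [pow_one, Set.range_id'] at this
  exact Set.infinite_univ this

theorem isInertial_of_isFinitary_of_comm {G : Type*} [Group G] (hG : ∀ a b : G, a * b = b * a)
    {γ : MulAut G} (hγ : IsFinitary γ) : IsInertial γ := by
  let _ : CommGroup G := { ‹Group G› with mul_comm := hG }
  exact isInertial_of_mem_FAut hγ

end Homs

/-! ### The critical case -/

section Critical

variable {p : ℕ} [Fact p.Prime] {A : Type*} [CommGroup A]

theorem IsCritical.divPart_ne_bot (hc : IsCritical A) : divPart A ≠ ⊥ := by
  obtain ⟨D, B, -, hne, hD, -⟩ := hc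
  exact fun hbot => hne (eq_bot_iff.2 (((isGreatest_divPart A).2 hD).trans hbot.le))

/-- The divisible summand in the definition of criticality is `D(A)`: if `N` kills the bounded
summand, then `N`-th powers, and so all divisible elements, lie in it. -/
theorem IsCritical.exists_isCompl (hc : IsCritical A) : HasFiniteRank (divPart A) ∧
    ∃ B₀ : Subgroup A, IsCompl (divPart A) B₀ ∧ Infinite B₀ ∧ IsBddExponent B₀ := by
  obtain ⟨D, B₀, hDB, hne, hD, hr, hi, N, hN, hb⟩ := hc
  have hle : divPart A ≤ D := by
    intro x hx
    obtain ⟨y, -, rfl⟩ := isDivisible_divPart A N hN x hx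
    rw [← projLeft_mul_projRight hDB y, mul_pow, hb _ (projRight hDB y).2, mul_one]
    exact pow_mem (projLeft hDB y).2 N
  have hDeq : D = divPart A := le_antisymm ((isGreatest_divPart A).2 hD) hle
  subst hDeq
  exact ⟨hr, B₀, hDB, hi, N, hN, hb⟩

theorem IsCritical.infinite_and_bounded (hc : IsCritical A) {B : Subgroup A}
    (h : IsCompl (divPart A) B) : Infinite B ∧ ∃ N ≠ 0, ∀ b : B, b ^ N = 1 := by
  obtain ⟨-, B₀, h₀, hi, N, hN, hb⟩ := hc.exists_isCompl
  constructor
  · refine Infinite.of_injective ((projRight h).comp B₀.subtype) ?_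
    rw [injective_iff_map_eq_one]
    intro b hb1
    have hbD : (b : A) ∈ divPart A := (projRight_eq_one_iff h).1 hb1
    exact Subtype.ext (Subgroup.disjoint_def.1 h₀.disjoint hbD b.2)
  · refine ⟨N, hN, fun b => Subtype.ext ?_⟩
    refine Subgroup.disjoint_def.1 h.disjoint ?_ (pow_mem b.2 N)
    show (b : A) ^ N ∈ divPart A
    rw [← projLeft_mul_projRight h₀ (b : A), mul_pow, hb _ (projRight h₀ (b : A)).2, mul_one]
    exact pow_mem (projLeft h₀ (b : A)).2 N

theorem not_isCritical_of_pow_eq_one {N : ℕ} (hN : N ≠ 0) (h : ∀ a : A, a ^ N = 1) :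
    ¬ IsCritical A := by
  rintro ⟨D, -, -, hne, hD, -⟩
  exact hne (eq_bot_of_isDivisible_of_pow_eq_one hD hN fun x _ => h x)

/-- Every subgroup of finite index contains `D`, whose elements are powers to the index. -/
theorem apply_eq_of_mem_FAut {γ : MulAut A} (hγ : γ ∈ FAut A) {d : A} (hd : d ∈ divPart A) :
    γ d = d := by
  obtain ⟨K, hK, hfix⟩ := hγ
  obtain ⟨e, -, rfl⟩ := isDivisible_divPart A K.index hK.index_ne_zero d hd
  exact hfix _ (K.pow_index_mem e)

theorem normal_FAut : (FAut A).Normal := by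
  refine ⟨fun f hf g => ?_⟩
  obtain ⟨K, hK, hfix⟩ := hf
  refine ⟨K.comap (g⁻¹).toMonoidHom, ⟨?_⟩, fun a ha => ?_⟩
  · rw [Subgroup.index_comap_of_surjective K (f := (g⁻¹).toMonoidHom) (g⁻¹).surjective]
    exact hK.index_ne_zero
  · have h1 : f (g⁻¹ a) = g⁻¹ a := hfix _ ha
    rw [MulAut.mul_apply, MulAut.mul_apply, h1, MulAut.apply_inv_self]

theorem eq_one_of_mem_PAut_of_fix (hA : IsPGroup p A) (hne : divPart A ≠ ⊥) {α : MulAut A}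
    (hα : α ∈ PAut A) (hfix : ∀ d ∈ divPart A, α d = d) : α = 1 := by
  have hp : p.Prime := Fact.out
  refine eq_one_of_mem_PAut hA hα (fun k => ?_) hfix
  obtain ⟨d, hd, hdo⟩ :=
    exists_orderOf_eq_of_isDivisible hA (isDivisible_divPart A) hne (k + 1)
  refine ⟨d, hd, fun h1 => ?_⟩
  have h2 := Nat.le_of_dvd (pow_pos hp.pos _) (orderOf_dvd_of_pow_eq_one h1)
  rw [hdo] at h2
  exact absurd h2 (not_le.2 (Nat.pow_lt_pow_right hp.one_lt (Nat.lt_succ_self k)))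

variable {B : Subgroup A} (h : IsCompl (divPart A) B)

theorem St_le_FAut (h : IsCompl (divPart A) B) (hD : HasFiniteSocle p (divPart A)) {m : ℕ} (hB : ∀ b : B, b ^ p ^ m = 1) :
    St (divPart A) ≤ FAut A := by
  intro σ hσ
  rw [mem_FAut_iff]
  obtain ⟨f, hf⟩ := (stEquiv h).surjective ⟨σ, hσ⟩
  refine ((hD.finite_pow_eq_one m).image Subtype.val).subset ?_
  rintro _ ⟨a, rfl⟩
  refine ⟨f (projRight h a), ?_, ?_⟩
  · show f (projRight h a) ^ p ^ m = 1
    rw [← map_pow, hB, map_one]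
  · have h1 : σ a = a * f (projRight h a) := by
      rw [← stEquiv_apply, hf]
    rw [MonoidHom.div_apply]
    show _ = σ a / a
    rw [h1, mul_div_cancel_left]

/-- For `a = d * b` in `H` the image `d * b ^ n = a ^ n * d ^ (1 - n)` is congruent to `d ^ (1 - n)`
modulo `H`. Since `d ^ p ^ m = a ^ p ^ m ∈ H`, the class of `d` lies in the `p ^ m`-torsion of the
image of `D`, which is finite. -/
theorem isInertial_oneSum_of_zpow (hA : IsPGroup p A) (hD : HasFiniteSocle p (divPart A)) {m : ℕ}
    (hB : ∀ b : B, b ^ p ^ m = 1) {α : MulAut B} {n : ℤ} (hα : ∀ b, α b = b ^ n) :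
    IsInertial (oneSum h α) := by
  rw [isInertial_iff]
  intro H
  set π : divPart A →* A ⧸ H := (QuotientGroup.mk' H).comp (divPart A).subtype with hπ
  have hs : HasFiniteSocle p π.range :=
    hD.of_surjective (hA.to_subgroup _) π.rangeRestrict_surjective
  refine (((hs.finite_pow_eq_one m).image Subtype.val).image fun q => q ^ (1 - n)).subset ?_
  rintro _ ⟨a, ha, rfl⟩
  refine ⟨π (projLeft h a), ⟨⟨_, projLeft h a, rfl⟩, ?_, rfl⟩, ?_⟩
  · refine Subtype.ext ?_
    show ((projLeft h a : A) : A ⧸ H) ^ p ^ m = 1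
    rw [← QuotientGroup.mk_pow, QuotientGroup.eq_one_iff]
    have h1 : (projLeft h a : A) ^ p ^ m = a ^ p ^ m := by
      have h2 : (projRight h a : A) ^ p ^ m = 1 := congrArg Subtype.val (hB (projRight h a))
      conv_rhs => rw [← projLeft_mul_projRight h a, mul_pow, h2, mul_one]
    rw [h1]
    exact pow_mem ha _
  · show ((projLeft h a : A) : A ⧸ H) ^ (1 - n) = ((oneSum h α a : A) : A ⧸ H)
    rw [← QuotientGroup.mk_zpow, QuotientGroup.eq, oneSum_apply', hα, Subgroup.coe_zpow]
    have h1 : ((projLeft h a : A) ^ (1 - n))⁻¹ * (projLeft h a * (projRight h a : A) ^ n) = a ^ n := by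
      conv_rhs => rw [← projLeft_mul_projRight h a, mul_zpow]
      rw [zpow_sub, zpow_one, mul_inv, inv_inv, ← mul_assoc, mul_right_comm _ ((projLeft h a : A) ^ n),
        inv_mul_cancel, one_mul]
    rw [h1]
    exact zpow_mem ha n

/-- Homomorphisms trivial on the finite image `E` of `f⁻¹ - 1` are fixed by the action. They form
the kernel of the restriction to `Hom(E, D)`, a finite group. -/
theorem isFinitary_conjSt (hD : HasFiniteSocle p (divPart A)) {m : ℕ}
    (hB : ∀ b : B, b ^ p ^ m = 1) {f : MulAut B} (hf : f ∈ FAut B) :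
    IsFinitary (conjSt (oneSum h f)) := by
  have hE : Finite ((f⁻¹).toMonoidHom / MonoidHom.id B).range := mem_FAut_iff.1 (inv_mem hf)
  set E := ((f⁻¹).toMonoidHom / MonoidHom.id B).range with hEdef
  have hfin : Finite (E →* divPart A) := finite_hom hD (m := m) fun c => Subtype.ext (hB c)
  set r : St (divPart A) →* (E →* divPart A) :=
    (MonoidHom.compHom' E.subtype).comp (stEquiv h).symm.toMonoidHom with hr
  refine ⟨r.ker, inferInstance, fun σ hσ => ?_⟩
  obtain ⟨g, rfl⟩ := (stEquiv h).surjective σ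
  rw [conjSt_oneSum]
  congr 1
  ext1 b
  have h1 : r (stEquiv h g) ⟨(f⁻¹).toMonoidHom b / b, b, rfl⟩ = 1 := by
    rw [MonoidHom.mem_ker] at hσ
    rw [hσ]
    rfl
  have h2 : r (stEquiv h g) = g.comp E.subtype := by
    show (((stEquiv h).symm (stEquiv h g)).comp E.subtype) = _
    rw [MulEquiv.symm_apply_apply]
  rw [h2] at h1
  have h3 : g ((f⁻¹).toMonoidHom b / b) = 1 := h1
  rwa [map_div, div_eq_one] at h3

theorem conjSt_oneSum_mem_PAut {α : MulAut B} {n k : ℤ} (hα : ∀ b, α b = b ^ n)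
    (hα' : ∀ b, α⁻¹ b = b ^ k) : conjSt (oneSum h α) ∈ PAut (St (divPart A)) := by
  intro H
  refine le_antisymm ?_ fun σ hσ => ?_
  · rintro _ ⟨σ, hσ, rfl⟩
    have := conjSt_oneSum_inv h hα' σ
    rw [map_inv, inv_inv] at this
    show conjSt (oneSum h α) σ ∈ H
    rw [this]
    exact zpow_mem hσ k
  · refine ⟨σ ^ n, zpow_mem hσ n, ?_⟩
    show conjSt (oneSum h α) (σ ^ n) = σ
    rw [← conjSt_oneSum_inv h hα, conjSt_inv]
    exact MulAut.apply_inv_self _ _ _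

theorem eq_one_of_conjSt_eq_one (hA : IsPGroup p A) (hne : divPart A ≠ ⊥) {γ : MulAut B}
    (hγ : conjSt (oneSum h γ) = 1) : γ = 1 := by
  rw [← inv_eq_one]
  ext1 b
  by_contra hb
  obtain ⟨f, hf⟩ := exists_hom_apply_ne_one hA (hA.to_subgroup B) (isDivisible_divPart A) hne
    (b := γ⁻¹ b / b) (fun h1 => hb (div_eq_one.1 h1))
  apply hf
  rw [map_div, div_eq_one]
  have h1 := conjSt_oneSum h γ f
  rw [hγ, MulAut.one_apply] at h1
  exact (DFunLike.congr_fun ((stEquiv h).injective h1) b).symm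

/-- On the bounded group `B` every power automorphism is multiplication by an integer prime to `p`,
so `Δ` is the image of `PAut B` and in particular a subgroup. -/
theorem coe_map_PAut {m : ℕ} (hB : ∀ b : B, b ^ p ^ m = 1) :
    (((PAut B).map (oneSum h) : Subgroup (MulAut A)) : Set (MulAut A)) =
      {δ | ∃ n : ℤ, ¬ (p : ℤ) ∣ n ∧ IsOneSumInt (divPart A) B n δ} := by
  have hp : p.Prime := Fact.out
  have : NeZero (p ^ m) := ⟨pow_ne_zero _ hp.ne_zero⟩
  ext δ
  constructor
  · rintro ⟨α, hα, rfl⟩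
    obtain ⟨n, hn, h1⟩ := exists_int_of_mem_PAut hB hα
    exact ⟨n, hn, (isOneSumInt_iff h h1).2 rfl⟩
  · rintro ⟨n, hn, hδ⟩
    obtain ⟨u, hu⟩ := isUnit_intCast_of_not_dvd (p := p) m hn
    exact ⟨unitsPow hB u, unitsPow_mem_PAut hB u,
      ((isOneSumInt_iff h (unitsPow_apply_of_eq hB u hu.symm)).1 hδ).symm⟩

theorem IAut_eq_FAut_mul_PAut {m : ℕ} (hB : ∀ b : A, b ^ p ^ m = 1) :
    (IAut A : Set (MulAut A)) = (FAut A : Set (MulAut A)) * (PAut A : Set (MulAut A)) := by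
  have hp : p.Prime := Fact.out
  have hA := isPGroup_of_pow_eq_one hB
  have := normal_PAut hA
  rw [IAut_eq_of_not_isCritical hA (not_isCritical_of_pow_eq_one (pow_ne_zero m hp.ne_zero) hB),
    ← Subgroup.normal_mul (PAut A), ← Subgroup.mul_normal (FAut A), sup_comm]

theorem IAut_le_sup (hA : IsPGroup p A) (hne : divPart A ≠ ⊥) :
    IAut A ≤ PAut A ⊔ (St (divPart A) ⊔ (IAut B).map (oneSum h)) := by
  refine (Subgroup.closure_le _).2 fun γ hγ => ?_
  obtain ⟨α, hα, hαγ⟩ := exists_mem_PAut_of_mem_zpowers hA hne (γ := γ) fun z hz =>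
    (isInertial_iff.1 hγ).mem_zpowers_of_isDivisible hA (isDivisible_divPart A) hz
  have hin : IsInertial (α⁻¹ * γ) := isInertial_mul_of_mem_PAut (inv_mem hα) hγ
  have hfix : ∀ d ∈ divPart A, (α⁻¹ * γ) d = d := fun d hd => by
    rw [MulAut.mul_apply, hαγ d hd, MulAut.inv_apply_self]
  obtain ⟨γ₀, hγ₀⟩ := exists_projRight_apply h hfix
  have h1 := mul_oneSum_inv_mem_St h hfix hγ₀
  have h2 : γ₀ ∈ IAut B := Subgroup.subset_closure (isInertial_of_projRight h hγ₀ hin)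
  have h3 : γ = α * ((α⁻¹ * γ * (oneSum h γ₀)⁻¹) * oneSum h γ₀) := by
    rw [inv_mul_cancel_right, mul_inv_cancel_left]
  rw [h3]
  exact Subgroup.mul_mem_sup hα (Subgroup.mul_mem_sup h1 ⟨γ₀, h2, rfl⟩)

theorem FAut_eq_mul (hD : HasFiniteSocle p (divPart A)) {m : ℕ} (hB : ∀ b : B, b ^ p ^ m = 1) :
    (FAut A : Set (MulAut A)) =
      (St (divPart A) : Set (MulAut A)) * ((FAut B).map (oneSum h) : Subgroup (MulAut A)) := by
  rw [← Subgroup.normal_mul]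
  congr 1
  refine le_antisymm (fun γ hγ => ?_) (sup_le (St_le_FAut h hD hB) ?_)
  · have hfix : ∀ d ∈ divPart A, γ d = d := fun d hd => apply_eq_of_mem_FAut hγ hd
    obtain ⟨γ₀, hγ₀⟩ := exists_projRight_apply h hfix
    rw [← inv_mul_cancel_right γ (oneSum h γ₀)]
    exact Subgroup.mul_mem_sup (mul_oneSum_inv_mem_St h hfix hγ₀)
      ⟨γ₀, mem_FAut_of_projRight h hγ₀ hγ, rfl⟩
  · rintro _ ⟨f, hf, rfl⟩
    exact (oneSum_mem_FAut_iff h).2 hf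

theorem map_IAut_eq_mul {m : ℕ} (hB : ∀ b : B, b ^ p ^ m = 1) :
    (((IAut B).map (oneSum h) : Subgroup (MulAut A)) : Set (MulAut A)) =
      ((FAut B).map (oneSum h) : Subgroup (MulAut A)) *
        ((PAut B).map (oneSum h) : Subgroup (MulAut A)) := by
  rw [Subgroup.coe_map, Subgroup.coe_map, Subgroup.coe_map, IAut_eq_FAut_mul_PAut hB,
    Set.image_mul]

theorem apply_eq_of_mem_sup {γ : MulAut A} (hγ : γ ∈ FAut A ⊔ (PAut B).map (oneSum h)) {d : A}
    (hd : d ∈ divPart A) : γ d = d := by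
  have hle : FAut A ⊔ (PAut B).map (oneSum h) ≤ fixer ⊤ (divPart A) := by
    refine sup_le (fun f hf => ⟨trivial, fun d hd => apply_eq_of_mem_FAut hf hd⟩) ?_
    rintro _ ⟨α, -, rfl⟩
    exact ⟨trivial, fun d hd => oneSum_apply_left h α hd⟩
  exact (hle hγ).2 d hd

/-- A cycle of inclusions: `ΣΨ ≤ FAut(A)Δ ≤ C(D) ≤ ΣΨ`. The last one holds because a power
automorphism trivial on `D ≠ 0` is trivial. -/
theorem sup_eq_St_sup (hA : IsPGroup p A) (hne : divPart A ≠ ⊥)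
    (hD : HasFiniteSocle p (divPart A)) {m : ℕ} (hB : ∀ b : B, b ^ p ^ m = 1) :
    FAut A ⊔ (PAut B).map (oneSum h) = St (divPart A) ⊔ (IAut B).map (oneSum h) ∧
      IAut A = PAut A ⊔ (FAut A ⊔ (PAut B).map (oneSum h)) ∧
      FAut A ⊔ (PAut B).map (oneSum h) = fixer (IAut A) (divPart A) := by
  have hle : St (divPart A) ⊔ (IAut B).map (oneSum h) ≤ FAut A ⊔ (PAut B).map (oneSum h) := by
    refine sup_le ((St_le_FAut h hD hB).trans le_sup_left) fun γ hγ => ?_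
    have hγ' : γ ∈ (((IAut B).map (oneSum h) : Subgroup (MulAut A)) : Set (MulAut A)) := hγ
    rw [map_IAut_eq_mul h hB] at hγ'
    obtain ⟨f, ⟨f₀, hf₀, rfl⟩, g, hg, rfl⟩ := hγ'
    exact Subgroup.mul_mem_sup ((oneSum_mem_FAut_iff h).2 hf₀) hg
  have hleI : FAut A ⊔ (PAut B).map (oneSum h) ≤ IAut A := by
    refine sup_le FAut_le_IAut ?_
    rintro _ ⟨α, hα, rfl⟩
    obtain ⟨n, -, hn⟩ := exists_int_of_mem_PAut hB hα
    exact Subgroup.subset_closure (isInertial_oneSum_of_zpow h hA hD hB hn)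
  have hP := normal_PAut hA
  have hfix : fixer (IAut A) (divPart A) ≤ St (divPart A) ⊔ (IAut B).map (oneSum h) := by
    rintro γ ⟨hγ, hγD⟩
    have hmem := IAut_le_sup h hA hne hγ
    rw [← SetLike.mem_coe, Subgroup.normal_mul] at hmem
    obtain ⟨α, hα, g, hg, rfl⟩ := hmem
    have hα1 : α = 1 := eq_one_of_mem_PAut_of_fix hA hne hα fun d hd => by
      have h1 := hγD d hd
      simp only [MulAut.mul_apply] at h1
      rwa [apply_eq_of_mem_sup h (hle hg) hd] at h1
    subst hα1
    simpa using hg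
  have hlef : FAut A ⊔ (PAut B).map (oneSum h) ≤ fixer (IAut A) (divPart A) := fun γ hγ =>
    ⟨hleI hγ, fun d hd => apply_eq_of_mem_sup h hγ hd⟩
  refine ⟨le_antisymm (hlef.trans hfix) hle, ?_, le_antisymm hlef (hfix.trans hle)⟩
  refine le_antisymm ?_ (sup_le PAut_le_IAut hleI)
  exact (IAut_le_sup h hA hne).trans (sup_le_sup_left hle _)

end Critical

/-! ### Exponents of bounded groups are natural numbers -/

section Exponents

variable {p : ℕ} [Fact p.Prime] {G : Type*} [Group G]

theorem exists_pExp_eq {m : ℕ} (h : ∀ g : G, g ^ p ^ m = 1) :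
    ∃ m' : ℕ, pExp p G = m' := by
  classical
  have hex : ∃ m, ∀ g : G, g ^ p ^ m = 1 := ⟨m, h⟩
  exact ⟨Nat.find hex, sInf_image_coe_eq_coe.2 ⟨Nat.find_spec hex, fun _ hj =>
    Nat.find_min' hex hj⟩⟩

theorem exists_eExp_eq {m : ℕ} (h : ∀ g : G, g ^ p ^ m = 1) :
    ∃ e' : ℕ, eExp p G = e' := by
  classical
  have hex : ∃ e, (Set.range fun g : G => g ^ p ^ e).Finite :=
    ⟨m, by simp only [h]; exact (Set.finite_singleton (1 : G)).subset Set.range_const_subset⟩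
  exact ⟨Nat.find hex, sInf_image_coe_eq_coe.2 ⟨Nat.find_spec hex, fun _ hj =>
    Nat.find_min' hex hj⟩⟩

end Exponents

/-! ### Assembling the critical case -/

section Conclusions

variable {p : ℕ} [Fact p.Prime] {A : Type*} [CommGroup A] {B : Subgroup A}
  (h : IsCompl (divPart A) B)

theorem isInternalDirect_IAut (hA : IsPGroup p A) (hne : divPart A ≠ ⊥)
    (hD : HasFiniteSocle p (divPart A)) {m : ℕ} (hB : ∀ b : B, b ^ p ^ m = 1) :
    IsInternalDirect (PAut A) (FAut A ⊔ (PAut B).map (oneSum h)) (IAut A) := by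
  have hP := normal_PAut hA
  refine ⟨fun α hα f _ => mul_comm_of_mem_PAut hA hα f, ?_, ?_⟩
  · rw [eq_bot_iff]
    rintro α ⟨hα, hα'⟩
    exact Subgroup.mem_bot.2 (eq_one_of_mem_PAut_of_fix hA hne hα fun d hd =>
      apply_eq_of_mem_sup h hα' hd)
  · conv_lhs => rw [(sup_eq_St_sup h hA hne hD hB).2.1]
    exact Subgroup.normal_mul _ _

theorem isInternalSemidirect_sup (hA : IsPGroup p A) (hne : divPart A ≠ ⊥)
    (hD : HasFiniteSocle p (divPart A)) {m : ℕ} (hB : ∀ b : B, b ^ p ^ m = 1) :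
    IsInternalSemidirect (St (divPart A)) ((IAut B).map (oneSum h))
      (FAut A ⊔ (PAut B).map (oneSum h)) := by
  refine ⟨fun l _ n hn => normal_St_divPart.conj_mem n hn l, St_inf_map_oneSum h _, ?_⟩
  rw [(sup_eq_St_sup h hA hne hD hB).1]
  exact Subgroup.normal_mul _ _

theorem isInternalSemidirect_FAut (hD : HasFiniteSocle p (divPart A)) {m : ℕ}
    (hB : ∀ b : B, b ^ p ^ m = 1) :
    IsInternalSemidirect (St (divPart A)) ((FAut B).map (oneSum h)) (FAut A) :=
  ⟨fun l _ n hn => normal_St_divPart.conj_mem n hn l, St_inf_map_oneSum h _, FAut_eq_mul h hD hB⟩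

theorem commutator_map_eq_bot (hA : IsPGroup p A) :
    ⁅(FAut B).map (oneSum h), (PAut B).map (oneSum h)⁆ = ⊥ := by
  rw [eq_bot_iff, Subgroup.commutator_le]
  rintro _ ⟨f, -, rfl⟩ _ ⟨α, hα, rfl⟩
  rw [Subgroup.mem_bot, commutatorElement_eq_one_iff_mul_comm, ← map_mul, ← map_mul,
    mul_comm_of_mem_PAut (hA.to_subgroup B) hα f]

/-- On `B` every element of `IAut B` is a power automorphism times a finitary one, and these act on
`Σ` as a power automorphism and a finitary one, whose product is inertial. -/
theorem isInertial_conjSt (hD : HasFiniteSocle p (divPart A)) {m : ℕ}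
    (hB : ∀ b : B, b ^ p ^ m = 1) {ψ : MulAut A} (hψ : ψ ∈ (IAut B).map (oneSum h)) :
    IsInertial (conjSt ψ) := by
  obtain ⟨γ, hγ, rfl⟩ := hψ
  rw [IAut_eq_FAut_mul_PAut hB] at hγ
  obtain ⟨f, hf, α, hα, rfl⟩ := hγ
  obtain ⟨n, -, hn⟩ := exists_int_of_mem_PAut hB hα
  obtain ⟨k, -, hk⟩ := exists_int_of_mem_PAut hB (inv_mem hα)
  show IsInertial (conjSt (oneSum h (f * α)))
  rw [← mul_comm_of_mem_PAut (isPGroup_of_pow_eq_one hB) hα f, map_mul, conjSt_mul]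
  exact isInertial_mul_of_mem_PAut (conjSt_oneSum_mem_PAut h hn hk)
    (isInertial_of_isFinitary_of_comm (mul_comm_of_St h) (isFinitary_conjSt h hD hB hf))

theorem FAut_inf_map_PAut : FAut A ⊓ (PAut B).map (oneSum h) =
    (PAut B ⊓ FAut B).map (oneSum h) := by
  ext δ
  constructor
  · rintro ⟨h1, α, hα, rfl⟩
    exact ⟨α, ⟨hα, (oneSum_mem_FAut_iff h).1 h1⟩, rfl⟩
  · rintro ⟨α, ⟨hα, h1⟩, rfl⟩
    exact ⟨(oneSum_mem_FAut_iff h).2 h1, α, hα, rfl⟩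

theorem exists_mem_PAut_zpow {m : ℕ} (hB : ∀ a : A, a ^ p ^ m = 1) {n : ℤ} (hn : ¬ (p : ℤ) ∣ n) :
    ∃ α ∈ PAut A, ∀ a, α a = a ^ n := by
  have hp : p.Prime := Fact.out
  have : NeZero (p ^ m) := ⟨pow_ne_zero _ hp.ne_zero⟩
  obtain ⟨u, hu⟩ := isUnit_intCast_of_not_dvd (p := p) m hn
  exact ⟨unitsPow hB u, unitsPow_mem_PAut hB u, unitsPow_apply_of_eq hB u hu.symm⟩

theorem nonempty_PAut_mulEquiv_units {m : ℕ} (hm : pExp p A = m) :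
    Nonempty (PAut A ≃* (ZMod (p ^ m))ˣ) := by
  have hm' := sInf_image_coe_eq_coe.1 hm
  exact ⟨((MonoidHom.ofInjective (unitsPow_injective hm')).trans
    (MulEquiv.subgroupCongr (range_unitsPow hm'.1))).symm⟩

end Conclusions

end InertialAut


theorem mainTheorem6 (p : ℕ) (hp : p.Prime) (A : Type*) [CommGroup A] (hA : IsPGroup p A) :
    -- the non-critical case
    (¬ InertialAut.IsCritical A →
      (InertialAut.IAut A : Set (MulAut A)) =
          (InertialAut.PAut A : Set (MulAut A)) * (InertialAut.FAut A : Set (MulAut A)) ∧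
      (InertialAut.pExp p A = ⊤ → InertialAut.PAut A ⊓ InertialAut.FAut A = ⊥) ∧
      (Finite A → InertialAut.PAut A ⊓ InertialAut.FAut A = InertialAut.PAut A) ∧
      (∀ m e : ℕ, Infinite A → InertialAut.pExp p A = m → InertialAut.eExp p A = e →
        Nat.card ↥(InertialAut.PAut A ⊓ InertialAut.FAut A) = p ^ (m - e) ∧
        (IsCyclic ↥(InertialAut.PAut A ⊓ InertialAut.FAut A) ↔
          ¬ (p = 2 ∧ e = 1 ∧ 3 ≤ m)))) ∧
    -- the critical case
    (InertialAut.IsCritical A →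
      ∀ (B : Subgroup A) (hB : IsCompl (InertialAut.divPart A) B),
      ∃ S Δ Φ Ψ : Subgroup (MulAut A),
        S = InertialAut.St (InertialAut.divPart A) ∧
        (Δ : Set (MulAut A)) =
          {δ | ∃ n : ℤ, ¬ (p : ℤ) ∣ n ∧ InertialAut.IsOneSumInt (InertialAut.divPart A) B n δ} ∧
        Φ = (InertialAut.FAut B).map (InertialAut.oneSum hB) ∧
        Ψ = (InertialAut.IAut B).map (InertialAut.oneSum hB) ∧
        -- the decompositions of `IAut A`, of `FAut A · Δ` and of `FAut A`
        ((InertialAut.FAut A ⊔ Δ : Subgroup (MulAut A)) : Set (MulAut A)) =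
          (InertialAut.FAut A : Set (MulAut A)) * (Δ : Set (MulAut A)) ∧
        InertialAut.IsInternalDirect (InertialAut.PAut A) (InertialAut.FAut A ⊔ Δ)
          (InertialAut.IAut A) ∧
        InertialAut.FAut A ⊔ Δ =
          InertialAut.fixer (InertialAut.IAut A) (InertialAut.divPart A) ∧
        InertialAut.IsInternalSemidirect S Ψ (InertialAut.FAut A ⊔ Δ) ∧
        InertialAut.IsInternalSemidirect S Φ (InertialAut.FAut A) ∧
        ∃ m' e' : ℕ, InertialAut.pExp p B = m' ∧ InertialAut.eExp p B = e' ∧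
          -- (i)
          (Infinite S ∧ IsMulCommutative S ∧ IsPGroup p S ∧
            InertialAut.pExp p S = m' ∧ InertialAut.eExp p S = e') ∧
          -- (ii)
          ((Ψ : Set (MulAut A)) = (Φ : Set (MulAut A)) * (Δ : Set (MulAut A)) ∧
            Nonempty (Ψ ≃* InertialAut.IAut B) ∧ ⁅Φ, Δ⁆ = ⊥ ∧
            (∀ ψ ∈ Ψ, InertialAut.IsInertial (InertialAut.conjSt ψ)) ∧
            (∀ ψ ∈ Ψ, InertialAut.conjSt ψ = 1 → ψ = 1)) ∧
          -- (iii)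
          (Nonempty (Δ ≃* InertialAut.PAut B) ∧
            Nonempty (InertialAut.PAut B ≃* (ZMod (p ^ m'))ˣ) ∧
            (∀ n : ℤ, ¬ (p : ℤ) ∣ n →
              ∃ δ ∈ Δ, InertialAut.IsOneSumInt (InertialAut.divPart A) B n δ ∧
                (∀ σ, InertialAut.conjSt δ⁻¹ σ = σ ^ n) ∧
                (∀ k : ℤ, n * k ≡ 1 [ZMOD (p : ℤ) ^ m'] →
                  ∀ σ, InertialAut.conjSt δ σ = σ ^ k)) ∧
            Nat.card ↥(InertialAut.FAut A ⊓ Δ) = p ^ (m' - e')) ∧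
          -- (iv)
          (Nonempty (Φ ≃* InertialAut.FAut B) ∧
            ∀ φ ∈ Φ, InertialAut.IsFinitary (InertialAut.conjSt φ))) := by
  have : Fact p.Prime := ⟨hp⟩
  refine ⟨fun hc => ⟨InertialAut.IAut_eq_of_not_isCritical hA hc,
    InertialAut.PAut_inf_FAut_eq_bot hA, fun _ => InertialAut.PAut_inf_FAut_of_finite,
    fun m e _ hm he => ⟨InertialAut.card_PAut_inf_FAut hm he,
      InertialAut.isCyclic_PAut_inf_FAut_iff hm he⟩⟩, fun hc B hB => ?_⟩
  have hne := hc.divPart_ne_bot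
  have hD : InertialAut.HasFiniteSocle p (InertialAut.divPart A) :=
    (InertialAut.hasFiniteRank_iff_hasFiniteSocle hA _).1 hc.exists_isCompl.1
  obtain ⟨hBi, N, hN, hBN⟩ := hc.infinite_and_bounded hB
  have hBp : ∀ b : B, b ^ p ^ N = 1 := fun b =>
    InertialAut.pow_prime_pow_eq_one (hA.to_subgroup B) hN (hBN b)
  obtain ⟨m', hm'⟩ := InertialAut.exists_pExp_eq hBp
  obtain ⟨e', he'⟩ := InertialAut.exists_eExp_eq hBp
  have hBm : ∀ b : B, b ^ p ^ m' = 1 := (InertialAut.sInf_image_coe_eq_coe.1 hm').1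
  have hsep : ∀ b : B, b ≠ 1 → ∃ f : B →* InertialAut.divPart A, f b ≠ 1 := fun b hb =>
    InertialAut.exists_hom_apply_ne_one hA (hA.to_subgroup B)
      (InertialAut.isDivisible_divPart A) hne hb
  have hinj := InertialAut.oneSum_injective hB
  have hnormal := InertialAut.normal_FAut (A := A)
  refine ⟨InertialAut.St (InertialAut.divPart A),
    (InertialAut.PAut B).map (InertialAut.oneSum hB),
    (InertialAut.FAut B).map (InertialAut.oneSum hB),
    (InertialAut.IAut B).map (InertialAut.oneSum hB), rfl,
    InertialAut.coe_map_PAut hB hBm, rfl, rfl, Subgroup.normal_mul _ _,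
    InertialAut.isInternalDirect_IAut hB hA hne hD hBm,
    (InertialAut.sup_eq_St_sup hB hA hne hD hBm).2.2,
    InertialAut.isInternalSemidirect_sup hB hA hne hD hBm,
    InertialAut.isInternalSemidirect_FAut hB hD hBm, m', e', hm', he',
    ⟨?_, ⟨⟨InertialAut.mul_comm_of_St hB⟩⟩, ?_, ?_, ?_⟩,
    ⟨InertialAut.map_IAut_eq_mul hB hBm,
      ⟨(Subgroup.equivMapOfInjective _ _ hinj).symm⟩,
      InertialAut.commutator_map_eq_bot hB hA,
      fun ψ hψ => InertialAut.isInertial_conjSt hB hD hBm hψ, ?_⟩,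
    ⟨⟨(Subgroup.equivMapOfInjective _ _ hinj).symm⟩,
      InertialAut.nonempty_PAut_mulEquiv_units hm', fun n hn => ?_, ?_⟩,
    ⟨(Subgroup.equivMapOfInjective _ _ hinj).symm⟩, ?_⟩
  · have := InertialAut.infinite_hom hD hBm hsep
    exact Infinite.of_injective _ (InertialAut.stEquiv hB).injective
  · refine IsPGroup.of_surjective (G := B →* InertialAut.divPart A) (fun f => ⟨m', ?_⟩)
      (InertialAut.stEquiv hB).toMonoidHom (InertialAut.stEquiv hB).surjective
    exact (InertialAut.forall_hom_pow_eq_one_iff hsep _).2 hBm f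
  · rw [← InertialAut.pExp_congr (InertialAut.stEquiv hB), InertialAut.pExp_hom hsep, hm']
  · rw [← InertialAut.eExp_congr (InertialAut.stEquiv hB), InertialAut.eExp_hom hD hBm hsep, he']
  · rintro _ ⟨γ, -, rfl⟩ hγ
    rw [InertialAut.eq_one_of_conjSt_eq_one hB hA hne hγ, map_one]
  · obtain ⟨α, hα, hαn⟩ := InertialAut.exists_mem_PAut_zpow hBm hn
    exact ⟨InertialAut.oneSum hB α, ⟨α, hα, rfl⟩,
      (InertialAut.isOneSumInt_iff hB hαn).2 rfl,
      InertialAut.conjSt_oneSum_inv hB hαn,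
      fun k hk => InertialAut.conjSt_oneSum_of_modEq hB hBm hαn hk⟩
  · rw [InertialAut.FAut_inf_map_PAut, Subgroup.card_map_of_injective hinj,
      InertialAut.card_PAut_inf_FAut hm' he']
  · rintro _ ⟨f, hf, rfl⟩
    exact InertialAut.isFinitary_conjSt hB hD hBm hf
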